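/- Let $(W,S)$ and $(U,T)$ be Coxeter systems with $S,T$ finite, and let $J\subseteq S$, $K\subseteq T$. Write $W_I$ for the subgroup generated by $I\subseteq S$, and order $W/W_J$ by the Bruhat order of $W$ restricted to the minimal-length representatives of the left cosets of $W_J$; similarly for $U$. Then $W/W_J\cong U/U_K$ as posets if and only if there are $n\in\mathbb N$ and disjoint unions $S=S_1\sqcup\dots\sqcup S_n$ and $T=T_1\sqcup\dots\sqcup T_n$ (possibly with some $S_i$ or $T_i$ empty), with $m(s,s')=2$ whenever $s,s'\in S$ lie in different $S_i$, or $s,s'\in T$ lie in different $T_i$ (that is, the Coxeter graphs are the disjoint unions of the graphs on the parts), such that for all $1\le i\le n$: - $(W_{S_i},S_i)$ and $(U_{T_i},T_i)$, with the restricted Coxeter matrices, are Coxeter systems each of which is irreducible (its Coxeter graph is nonempty and connected) or trivial (its generating set is empty), and - $W_{S_i}/W_{S_i\cap J}\cong U_{T_i}/U_{T_i\cap K}$ as posets with the Bruhat order. -/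

import Mathlib

namespace CoxeterMatrix

variable {B : Type*} (M : CoxeterMatrix B)

/-- The Coxeter graph: distinct generators `s`, `t` are joined by an edge when `m(s,t) ≠ 2`, that
is when `m(s,t) ≥ 3` or `m(s,t) = ∞` (Mathlib encodes `∞` as `0`). -/
def coxeterGraph : SimpleGraph B where
  Adj s t := s ≠ t ∧ M s t ≠ 2
  symm := ⟨fun s t h => ⟨h.1.symm, by rw [M.symmetric t s]; exact h.2⟩⟩
  loopless := ⟨fun _ h => h.1 rfl⟩

/-- The Coxeter matrix restricted to a set `I` of generators. -/
def restrict (I : Set B) : CoxeterMatrix I where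
  M := fun s t => M s t
  isSymm := by
    ext s t
    exact M.symmetric t s
  diagonal s := M.diagonal s
  off_diagonal s t h := M.off_diagonal s t (fun e => h (Subtype.ext e))

/-- A Coxeter matrix (or system) is irreducible if its Coxeter graph is connected
(in particular there is at least one generator). -/
def Irreducible : Prop := M.coxeterGraph.Connected

/-- The family `P` exhibits the Coxeter graph of `M` as a disjoint union: the set of generators is
the disjoint union of the `P i`, which may be empty, and no edge joins two different parts. -/
structure IsDisjointUnion {n : ℕ} (P : Fin n → Set B) : Prop where
  disjoint : ∀ i j, i ≠ j → Disjoint (P i) (P j)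
  cover : ⋃ i, P i = Set.univ
  no_edge : ∀ i j, i ≠ j → ∀ s ∈ P i, ∀ t ∈ P j, ¬ M.coxeterGraph.Adj s t

end CoxeterMatrix

namespace CoxeterSystem

variable {B W : Type*} [Group W] {M : CoxeterMatrix B} (cs : CoxeterSystem M W)

/-- The Bruhat order on `W`: `u ≤ v` when `v = u t₁ ⋯ tₙ` for some reflections `t₁, …, tₙ`
such that the length strictly increases at every step. -/
def BruhatLE : W → W → Prop :=
  Relation.ReflTransGen fun u v => ∃ t, cs.IsReflection t ∧ v = u * t ∧ cs.length u < cs.length v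

/-- The parabolic subgroup `W_J` generated by `J`. -/
def parabolic (J : Set B) : Subgroup W := Subgroup.closure (cs.simple '' J)

/-- `w` belongs to `W^J`: it has minimal length in its left coset `w W_J`. -/
def IsMinRep (J : Set B) (w : W) : Prop :=
  ∀ x ∈ cs.parabolic J, cs.length w ≤ cs.length (w * x)

/-- The Bruhat order on the set `W / W_J` of left cosets: the order induced by the Bruhat order
on the representatives of minimal length. -/
def QuotientLE (J : Set B) (x y : W ⧸ cs.parabolic J) : Prop :=
  ∃ u v : W, cs.IsMinRep J u ∧ cs.IsMinRep J v ∧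
    (u : W ⧸ cs.parabolic J) = x ∧ (v : W ⧸ cs.parabolic J) = y ∧ cs.BruhatLE u v

/-- `cs'` is the system `(W_I, I)`: its simple reflections are those of `cs` indexed by `I`.
Since the simple reflections determine a Coxeter system, there is at most one such `cs'`. -/
def IsRestriction (I : Set B) (cs' : CoxeterSystem (M.restrict I) (cs.parabolic I)) : Prop :=
  ∀ s : I, (cs'.simple s : W) = cs.simple s

end CoxeterSystem

/-! Write $W^J$ for the minimal representatives; it carries the order of $W/W_J$ (`quotientIso`).

If the Coxeter graph splits into parts with no edges between them, then $W$ is the direct product of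
the corresponding parabolic subgroups, and length, minimality and Bruhat order are all read off
componentwise. So $W^J$ is a product of posets, one for each part (`minRepProdIso`), and the factor
of a part $C$ is the quotient of the restricted system (`minRepIso`). Multiplying isomorphisms of
factors gives the "if" direction.

For "only if", the components that meet the complement of $J$ must be recovered from the abstract
poset $W^J$. Its least element is $1$ and its atoms are the generators outside $J$ (`relAtom_iff`).
Call atoms $s,t$ linked if some $x$ whose only atom is $s$ has no join with $t$. When $s,t$ lie in
different components, $x$ lies in the component of $s$ and $xt$ is the join, so linked atoms lie in
one component (`reachable_of_relLinked`). Conversely, take a path from a neighbour of $t$ to $s$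
with all vertices other than $s$ in $J$, and let $a$ be the product of the generators along it. Then
$a$, $ta$ and $at$ are in $W^J$ and $ta\neq at$; both cover the pair $a,t$ at length $\ell(a)+1$, so
there is no join (`relLinked_of_walk`). Hence the equivalence relation generated by links is
membership in the same component (`eqvGen_relLinked_iff`).

An isomorphism thus matches atoms and their components. Since $w\in W_C$ is decided by the atoms
below $w$, it restricts to isomorphisms of factors (`minRepRestrictIso`). A component contained in
$J$ or in $K$ has no atoms and a one-point quotient, so it is paired with the empty set. -/

namespace CoxeterMatrix

/-! ### The dual geometric representation -/

open Module Polynomial.Chebyshev Real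

variable {B : Type*} (M : CoxeterMatrix B)

/-- The vectors of the dual geometric representation: the simple reflection `s` acts on functions
`f : B → ℝ` by `f ↦ f - f s • M.geomVec s`. -/
noncomputable def geomVec (s : B) : B → ℝ := fun t => -(2 * cos (π / M s t))

@[simp]
lemma geomVec_self (s : B) : M.geomVec s s = 2 := by simp [geomVec]

lemma geomVec_symm (s t : B) : M.geomVec s t = M.geomVec t s := by
  simp [geomVec, M.symmetric s t]

lemma geomVec_eq_zero_iff (s t : B) : M.geomVec s t = 0 ↔ M s t = 2 := by
  constructor
  · intro h
    have h1 : cos (π / M s t) = 0 := by simpa [geomVec] using h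
    rcases Nat.lt_or_ge (M s t) 3 with h3 | h3
    -- The entry 0 encodes ∞. Division by zero gives `cos 0 = 1`, which is the intended limiting
    -- value.
    · interval_cases hm : M s t
      · simp at h1
      · simp at h1
      · rfl
    · exfalso
      have h3' : (3 : ℝ) ≤ M s t := by exact_mod_cast h3
      have : 0 < cos (π / M s t) := by
        apply cos_pos_of_mem_Ioo
        constructor
        · have := pi_pos
          have : 0 ≤ π / M s t := by positivity
          linarith
        · rw [div_lt_div_iff₀ (by linarith) (by norm_num)]
          nlinarith [pi_pos]
      linarith
  · intro h
    simp [geomVec, h]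

/-- The action of a simple reflection in the dual geometric representation. -/
noncomputable def geomReflection (s : B) : (B → ℝ) ≃ₗ[ℝ] (B → ℝ) :=
  reflection (x := M.geomVec s) (f := LinearMap.proj s) (by simp)

lemma geomReflection_apply (s : B) (f : B → ℝ) :
    M.geomReflection s f = f - f s • M.geomVec s := by
  simp [geomReflection, reflection_apply]

lemma eval_S_mul_sin (θ : ℝ) (k : ℤ) :
    (S ℝ k).eval (2 * cos θ) * sin θ = sin ((k + 1) * θ) := by
  rw [← U_real_cos, S_eq_U_comp_half_mul_X]; simp

/-- Powers of a product of two reflections have coefficients given by the Chebyshev polynomials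
$S_k$ at $2\cos\theta$ with $\theta=2\pi/m$, and $S_{k-1}(2\cos\theta)\sin\theta=\sin k\theta$ makes
them vanish at the $m$-th power. -/
lemma isLiftable_geomReflection : M.IsLiftable M.geomReflection := by
  intro s t
  rcases eq_or_ne s t with rfl | hst
  · ext f u
    simp [geomReflection_apply]
    ring
  have hm1 : M s t ≠ 1 := M.off_diagonal s t hst
  rcases eq_or_ne (M s t) 0 with h0 | h0
  · simp [h0]
  -- Here $\theta=\pi$ and $\sin\theta=0$, so the Chebyshev argument below does not apply.
  rcases eq_or_ne (M s t) 2 with h2 | h2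
  · have e1 : M.geomVec s t = 0 := (M.geomVec_eq_zero_iff s t).2 h2
    have e2 : M.geomVec t s = 0 := by rw [geomVec_symm, e1]
    rw [h2]
    apply LinearEquiv.ext
    intro f
    simp only [pow_two, LinearEquiv.mul_apply, geomReflection_apply, LinearEquiv.coe_one, id]
    ext u
    simp [e1, e2]
    ring
  have h3 : 3 ≤ M s t := by omega
  have h3' : (3 : ℝ) ≤ M s t := by exact_mod_cast h3
  set θ : ℝ := 2 * π / M s t with hθ
  have hmθ : M s t * θ = 2 * π := by rw [hθ]; field_simp
  have hsin : 0 < sin θ := by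
    apply sin_pos_of_pos_of_lt_pi
    · rw [hθ]; have := pi_pos; positivity
    · rw [hθ, div_lt_iff₀ (by linarith)]; nlinarith [pi_pos]
  have ht : M.geomVec t s * M.geomVec s t - 2 = 2 * cos θ := by
    rw [M.geomVec_symm t s, hθ, mul_div_assoc, cos_two_mul, geomVec]
    ring
  apply LinearEquiv.ext
  intro f
  have key := reflection_mul_reflection_pow_apply (x := M.geomVec s) (y := M.geomVec t)
    (f := LinearMap.proj s) (g := LinearMap.proj t) (by simp) (by simp) (M s t) f
  simp only [LinearMap.proj_apply, ht] at key
  -- For $m=2k$ the factor $S_{k-1}$ vanishes because $k\theta=\pi$. For $m=2k+1$ the factor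
  -- $S_k+S_{k-1}$ vanishes because $(k+1)\theta=2\pi-k\theta$.
  have hzero : ((S ℝ ((M s t - 2) / 2)).eval (2 * cos θ) * ((S ℝ ((M s t - 1) / 2)).eval (2 * cos θ)
      + (S ℝ ((M s t - 3) / 2)).eval (2 * cos θ)) = 0) ∧
      ((S ℝ ((M s t - 1) / 2)).eval (2 * cos θ) * ((S ℝ (M s t / 2)).eval (2 * cos θ)
      + (S ℝ ((M s t - 2) / 2)).eval (2 * cos θ)) = 0) := by
    rcases Nat.even_or_odd' (M s t) with ⟨k, hk | hk⟩
    · have hS : (S ℝ (k - 1)).eval (2 * cos θ) = 0 := by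
        have := eval_S_mul_sin θ (k - 1)
        have e : ((((k : ℤ) - 1 : ℤ) : ℝ) + 1) * θ = π := by
          rw [hk] at hmθ; push_cast at hmθ ⊢; linarith
        rw [e, sin_pi] at this
        exact (mul_eq_zero.1 this).resolve_right hsin.ne'
      have a1 : ((M s t : ℤ) - 2) / 2 = k - 1 := by omega
      have a2 : ((M s t : ℤ) - 1) / 2 = k - 1 := by omega
      rw [a1, a2, hS]; simp
    · have hS : (S ℝ k).eval (2 * cos θ) + (S ℝ (k - 1)).eval (2 * cos θ) = 0 := by
        have h1 := eval_S_mul_sin θ (k - 1)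
        have h2 := eval_S_mul_sin θ k
        have e : (((k : ℤ) : ℝ) + 1) * θ = 2 * π - (((k : ℤ) - 1 : ℤ) + 1) * θ := by
          rw [hk] at hmθ; push_cast at hmθ ⊢; linarith
        rw [e, sin_two_pi_sub] at h2
        have : ((S ℝ k).eval (2 * cos θ) + (S ℝ (k - 1)).eval (2 * cos θ)) * sin θ = 0 := by
          rw [add_mul, h1, h2]; ring
        exact (mul_eq_zero.1 this).resolve_right hsin.ne'
      have a1 : ((M s t : ℤ) - 2) / 2 = k - 1 := by omega
      have a2 : ((M s t : ℤ) - 1) / 2 = k := by omega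
      have a3 : ((M s t : ℤ) - 3) / 2 = k - 1 := by omega
      have a4 : (M s t : ℤ) / 2 = k := by omega
      rw [a1, a2, a3, a4, hS]; simp
  rw [hzero.1, hzero.2] at key
  simpa [geomReflection] using key

end CoxeterMatrix

namespace CoxeterSystem

variable {B W : Type*} [Group W] {M : CoxeterMatrix B} (cs : CoxeterSystem M W)

/-- The dual geometric representation of a Coxeter group. -/
noncomputable def geomRep : W →* ((B → ℝ) ≃ₗ[ℝ] (B → ℝ)) :=
  cs.lift ⟨M.geomReflection, M.isLiftable_geomReflection⟩

@[simp]
lemma geomRep_simple (s : B) : cs.geomRep (cs.simple s) = M.geomReflection s :=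
  cs.lift_apply_simple _ s

/-- For $s\notin J$ every generator in $J$ fixes the indicator function of $s$, whereas $s$ sends
its value at $s$ from $1$ to $-1$. -/
lemma simple_mem_parabolic_iff {J : Set B} {s : B} : cs.simple s ∈ cs.parabolic J ↔ s ∈ J := by
  classical
  refine ⟨fun h => ?_, fun h => Subgroup.subset_closure ⟨s, h, rfl⟩⟩
  by_contra hs
  have key : ∀ w ∈ cs.parabolic J, cs.geomRep w (Pi.single s 1) = Pi.single s 1 := by
    intro w hw
    induction hw using Subgroup.closure_induction with
    | mem x hx =>
      obtain ⟨j, hj, rfl⟩ := hx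
      have : j ≠ s := by rintro rfl; exact hs hj
      simp [CoxeterMatrix.geomReflection_apply, this]
    | one => simp
    | mul x y _ _ hx hy => rw [map_mul, LinearEquiv.mul_apply, hy, hx]
    | inv x _ hx =>
      rw [map_inv]
      exact (LinearEquiv.symm_apply_eq _).2 hx.symm
  have h1 := congrFun (key _ h) s
  simp [CoxeterMatrix.geomReflection_apply] at h1

lemma simple_injective : Function.Injective cs.simple := by
  intro s t h
  have : cs.simple s ∈ cs.parabolic ({t} : Set B) := by
    rw [h]; exact cs.simple_mem_parabolic_iff.2 (Set.mem_singleton t)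
  exact Set.mem_singleton_iff.1 (cs.simple_mem_parabolic_iff.1 this)

/-- On the indicator function of $s$, the products $st$ and $ts$ produce opposite values at $t$,
namely $\mp$ the entry `M.geomVec s t`, so commuting forces that entry to be $0$. -/
lemma simple_mul_comm_iff {s t : B} (hst : s ≠ t) :
    cs.simple s * cs.simple t = cs.simple t * cs.simple s ↔ M s t = 2 := by
  classical
  constructor
  · intro h
    have h1 := congrArg (fun w => cs.geomRep w (Pi.single s 1) t) h
    simp [CoxeterMatrix.geomReflection_apply, hst.symm] at h1
    rw [← M.geomVec_eq_zero_iff]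
    linarith
  · intro h
    have := cs.simple_mul_simple_pow s t
    rw [h, pow_two, mul_eq_one_iff_eq_inv] at this
    simpa using this

end CoxeterSystem

/-! ### The strong exchange property -/

namespace CoxeterSystem

variable {B W : Type*} [Group W] {M : CoxeterMatrix B} (cs : CoxeterSystem M W)

section StrongExchange

open Classical in
/-- The action of a simple reflection on `W × ZMod 2` used to count inversions modulo two. -/
noncomputable def inversionPerm (i : B) : Equiv.Perm (W × ZMod 2) :=
  Function.Involutive.toPerm
    (fun p => (cs.simple i * p.1 * cs.simple i, p.2 + if p.1 = cs.simple i then 1 else 0)) (by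
      rintro ⟨x, ε⟩
      have h : cs.simple i * x * cs.simple i = cs.simple i ↔ x = cs.simple i := by
        rw [mul_assoc, mul_eq_left, ← cs.inv_simple i, mul_inv_eq_one]
        simp
      ext
      · simp [mul_assoc]
      · simp only [h]
        split_ifs
        · rw [add_assoc, CharTwo.add_self_eq_zero, add_zero]
        · simp)

open Classical in
lemma inversionPerm_apply (i : B) (p : W × ZMod 2) :
    cs.inversionPerm i p =
      (cs.simple i * p.1 * cs.simple i, p.2 + if p.1 = cs.simple i then 1 else 0) := rfl

open Classical in
lemma inversionPerm_mul_pow_apply (i j : B) (n : ℕ) (x : W) (ε : ZMod 2) :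
    ((cs.inversionPerm i * cs.inversionPerm j) ^ n) (x, ε) =
      ((cs.simple i * cs.simple j) ^ n * x * ((cs.simple i * cs.simple j) ^ n)⁻¹,
        ε + ∑ k ∈ Finset.range (2 * n),
          if x = cs.simple j * (cs.simple i * cs.simple j) ^ k then 1 else 0) := by
  set p := cs.simple i * cs.simple j with hp
  have hjp : ∀ k, (p ^ k)⁻¹ * cs.simple j = cs.simple j * p ^ k := by
    intro k
    have : cs.simple j * p * (cs.simple j)⁻¹ = p⁻¹ := by simp [hp, mul_assoc]
    rw [← inv_pow, ← this, conj_pow]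
    simp [mul_assoc]
  induction n with
  | zero => simp
  | succ n ih =>
    rw [pow_succ', Equiv.Perm.mul_apply, ih, Equiv.Perm.mul_apply, inversionPerm_apply,
      inversionPerm_apply, Nat.mul_succ, Finset.sum_range_succ, Finset.sum_range_succ]
    have h1 : p ^ n * x * (p ^ n)⁻¹ = cs.simple j ↔ x = cs.simple j * p ^ (2 * n) := by
      rw [mul_inv_eq_iff_eq_mul, ← eq_inv_mul_iff_mul_eq, ← mul_assoc, hjp, two_mul, pow_add,
        mul_assoc]
    have h2 : cs.simple j * (p ^ n * x * (p ^ n)⁻¹) * cs.simple j = cs.simple i ↔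
        x = cs.simple j * p ^ (2 * n + 1) := by
      have : cs.simple j * (p ^ n * x * (p ^ n)⁻¹) * cs.simple j = cs.simple i ↔
          p ^ n * x * (p ^ n)⁻¹ = cs.simple j * p := by
        constructor
        · intro h
          calc _ = cs.simple j * (cs.simple j * (p ^ n * x * (p ^ n)⁻¹) * cs.simple j) *
                cs.simple j := by simp [mul_assoc]
            _ = _ := by rw [h, hp, mul_assoc]
        · intro h
          rw [h, hp]; simp [mul_assoc]
      have e : (p ^ n)⁻¹ * (cs.simple j * p * p ^ n) = cs.simple j * p ^ (2 * n + 1) := by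
        rw [mul_assoc, ← mul_assoc _ (cs.simple j), hjp, mul_assoc, ← pow_succ', ← pow_add]
        congr 2
        ring
      rw [this, mul_inv_eq_iff_eq_mul, ← eq_inv_mul_iff_mul_eq, e]
    simp only [h1, h2]
    ext
    · simp only [hp, pow_succ', mul_inv_rev, inv_simple]
      group
    · simp only [add_assoc]

lemma isLiftable_inversionPerm : M.IsLiftable cs.inversionPerm := by
  classical
  intro i j
  ext1 ⟨x, ε⟩
  -- With $m=m(i,j)$, the summands at $k$ and $k+m$ agree since $(s_is_j)^m=1$, so the sum cancels
  -- modulo two.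
  rw [inversionPerm_mul_pow_apply, two_mul, Finset.sum_range_add]
  simp only [pow_add, simple_mul_simple_pow, one_mul]
  rw [CharTwo.add_self_eq_zero]
  simp

/-- The action of a Coxeter group on `W × ZMod 2` which counts inversions modulo two. -/
noncomputable def inversionRep : W →* Equiv.Perm (W × ZMod 2) :=
  cs.lift ⟨cs.inversionPerm, cs.isLiftable_inversionPerm⟩

lemma inversionRep_simple (i : B) : cs.inversionRep (cs.simple i) = cs.inversionPerm i :=
  cs.lift_apply_simple _ i

-- The left side depends only on the group element, so the parity with which `x` occurs in an
-- inversion sequence does not depend on the word.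
open Classical in
lemma inversionRep_wordProd_apply (ω : List B) (x : W) (ε : ZMod 2) :
    cs.inversionRep (cs.wordProd ω) (x, ε) =
      (cs.wordProd ω * x * (cs.wordProd ω)⁻¹, ε + (cs.rightInvSeq ω).count x) := by
  induction ω with
  | nil => simp
  | cons i ω ih =>
    have h : cs.wordProd ω * x * (cs.wordProd ω)⁻¹ = cs.simple i ↔
        (cs.wordProd ω)⁻¹ * cs.simple i * cs.wordProd ω = x := by
      constructor
      · intro h; rw [← h]; group
      · intro h; rw [← h]; group
    rw [wordProd_cons, map_mul, Equiv.Perm.mul_apply, ih, inversionRep_simple, inversionPerm_apply,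
      rightInvSeq, List.count_cons]
    ext
    · simp [mul_assoc]
    · simp only [h, beq_iff_eq]
      push_cast
      ring

lemma inversionRep_apply_fst (w x : W) (ε : ZMod 2) :
    (cs.inversionRep w (x, ε)).1 = w * x * w⁻¹ := by
  classical
  obtain ⟨ω, rfl⟩ := cs.wordProd_surjective w
  rw [inversionRep_wordProd_apply]

lemma inversionRep_apply_add (w x : W) (ε δ : ZMod 2) :
    (cs.inversionRep w (x, ε + δ)).2 = (cs.inversionRep w (x, ε)).2 + δ := by
  classical
  obtain ⟨ω, rfl⟩ := cs.wordProd_surjective w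
  rw [inversionRep_wordProd_apply, inversionRep_wordProd_apply]
  ring

lemma IsReflection.inversionRep_apply {cs : CoxeterSystem M W} {t : W} (ht : cs.IsReflection t)
    (ε : ZMod 2) : cs.inversionRep t (t, ε) = (t, ε + 1) := by
  obtain ⟨w, i, rfl⟩ := ht
  have h0 : cs.inversionRep w⁻¹ (w * cs.simple i * w⁻¹, ε) =
      (cs.simple i, (cs.inversionRep w⁻¹ (w * cs.simple i * w⁻¹, ε)).2) := by
    ext
    · rw [inversionRep_apply_fst]; group
    · rfl
  set δ := (cs.inversionRep w⁻¹ (w * cs.simple i * w⁻¹, ε)).2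
  have h1 : cs.inversionRep w (cs.simple i, δ) = (w * cs.simple i * w⁻¹, ε) := by
    rw [← h0, ← Equiv.Perm.mul_apply, ← map_mul]; simp
  rw [map_mul, map_mul, Equiv.Perm.mul_apply, Equiv.Perm.mul_apply, h0, inversionRep_simple,
    inversionPerm_apply]
  ext
  · rw [inversionRep_apply_fst]; simp
  · simp only [if_true, inversionRep_apply_add, simple_mul_simple_self, one_mul, h1]

/-- The strong exchange property: a right inversion of `w` occurs in the right inversion sequence of
every word for `w`. -/
theorem IsRightInversion.mem_rightInvSeq {cs : CoxeterSystem M W} {ω : List B} {t : W}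
    (h : cs.IsRightInversion (cs.wordProd ω) t) : t ∈ cs.rightInvSeq ω := by
  classical
  obtain ⟨ht, hlt⟩ := h
  by_contra hn
  have h0 : cs.inversionRep (cs.wordProd ω) (t, 0) =
      (cs.wordProd ω * t * (cs.wordProd ω)⁻¹, 0) := by
    rw [inversionRep_wordProd_apply, List.count_eq_zero_of_not_mem hn]; simp
  -- If $t$ does not occur for $w$, it has odd parity for $wt$, hence occurs for a reduced word of
  -- $wt$. Then $\ell(w)<\ell(wt)$, contrary to assumption.
  have h1 : (cs.inversionRep (cs.wordProd ω * t) (t, 0)).2 = 1 := by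
    rw [map_mul, Equiv.Perm.mul_apply, ht.inversionRep_apply, inversionRep_apply_add, h0]
    simp
  obtain ⟨ν, hν, hν'⟩ := cs.exists_isReduced (cs.wordProd ω * t)
  rw [hν', inversionRep_wordProd_apply] at h1
  have hmem : t ∈ cs.rightInvSeq ν := by
    by_contra hn'
    rw [List.count_eq_zero_of_not_mem hn'] at h1
    simp at h1
  have := (cs.isRightInversion_of_mem_rightInvSeq hν hmem).2
  rw [← hν', mul_assoc, ht.mul_self, mul_one] at this
  omega

/-- The strong exchange property, in terms of deletion of a letter. -/
theorem IsRightInversion.exists_eraseIdx {cs : CoxeterSystem M W} {ω : List B} {t : W}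
    (h : cs.IsRightInversion (cs.wordProd ω) t) :
    ∃ j < ω.length, cs.wordProd ω * t = cs.wordProd (ω.eraseIdx j) := by
  obtain ⟨j, hj, rfl⟩ := List.mem_iff_getElem.1 h.mem_rightInvSeq
  refine ⟨j, by simpa using hj, ?_⟩
  rw [← List.getD_eq_getElem _ 1 hj, wordProd_mul_getD_rightInvSeq]

end StrongExchange

end CoxeterSystem

/-! ### Parabolic subgroups and minimal coset representatives -/

namespace CoxeterSystem

variable {B W : Type*} [Group W] {M : CoxeterMatrix B} (cs : CoxeterSystem M W)

section Parabolic

variable {J : Set B}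

lemma simple_mem_parabolic {j : B} (hj : j ∈ J) : cs.simple j ∈ cs.parabolic J :=
  Subgroup.subset_closure ⟨j, hj, rfl⟩

lemma parabolic_mono {I J : Set B} (h : I ⊆ J) : cs.parabolic I ≤ cs.parabolic J :=
  Subgroup.closure_mono (Set.image_mono h)

lemma parabolic_empty : cs.parabolic ∅ = ⊥ := by simp [parabolic]

lemma parabolic_univ : cs.parabolic Set.univ = ⊤ := by
  rw [parabolic, Set.image_univ, subgroup_closure_range_simple]

lemma wordProd_mem_parabolic {ν : List B} (h : ∀ j ∈ ν, j ∈ J) :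
    cs.wordProd ν ∈ cs.parabolic J := by
  induction ν with
  | nil => simp
  | cons j ν ih =>
    rw [wordProd_cons]
    exact mul_mem (cs.simple_mem_parabolic (h j (by simp))) (ih fun k hk => h k (by simp [hk]))

lemma exists_word_of_mem_parabolic {x : W} (hx : x ∈ cs.parabolic J) :
    ∃ ν : List B, (∀ j ∈ ν, j ∈ J) ∧ cs.wordProd ν = x := by
  induction hx using Subgroup.closure_induction with
  | mem x hx =>
    obtain ⟨j, hj, rfl⟩ := hx
    exact ⟨[j], by simpa using hj, by simp⟩
  | one => exact ⟨[], by simp, by simp⟩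
  | mul x y _ _ hx hy =>
    obtain ⟨ν, hν, rfl⟩ := hx
    obtain ⟨μ, hμ, rfl⟩ := hy
    exact ⟨ν ++ μ, by simpa [or_imp, forall_and] using ⟨hν, hμ⟩, cs.wordProd_append _ _⟩
  | inv x _ hx =>
    obtain ⟨ν, hν, rfl⟩ := hx
    exact ⟨ν.reverse, by simpa using hν, cs.wordProd_reverse _⟩

variable {cs}

/-- If appending a letter shortened the product, strong exchange would delete a letter either from a
reduced word of `w`, giving a shorter element of its coset, or from `ν`, giving a shorter word in
`J`. Minimality of `ν` is only required among words in `J`; the case `w = 1` then shows that `ν` is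
reduced in `W`. -/
lemma IsMinRep.length_mul_wordProd {w : W} (hw : cs.IsMinRep J w) {ν : List B}
    (hν : ∀ j ∈ ν, j ∈ J)
    (hmin : ∀ μ : List B, (∀ j ∈ μ, j ∈ J) → cs.wordProd μ = cs.wordProd ν →
      ν.length ≤ μ.length) :
    cs.length (w * cs.wordProd ν) = cs.length w + ν.length := by
  induction ν using List.reverseRecOn with
  | nil => simp
  | append_singleton ν j ih =>
    have hνJ : ∀ k ∈ ν, k ∈ J := fun k hk => hν k (by simp [hk])
    have hj : j ∈ J := hν j (by simp)
    have ih := ih hνJ fun μ hμ h => by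
      have := hmin (μ ++ [j]) (by
        intro k hk
        rcases List.mem_append.1 hk with hk | hk
        · exact hμ k hk
        · rwa [List.mem_singleton.1 hk]) (by simp [wordProd_append, h])
      simpa using this
    obtain ⟨ω, hω, hωw⟩ := cs.exists_isReduced w
    have hωl : cs.length w = ω.length := by rw [hωw]; exact hω
    rw [wordProd_append, wordProd_singleton, ← mul_assoc, List.length_append,
      List.length_singleton]
    rcases cs.length_mul_simple (w * cs.wordProd ν) j with h | h
    · omega
    exfalso
    have hinv : cs.IsRightInversion (cs.wordProd (ω ++ ν)) (cs.simple j) := by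
      refine ⟨cs.isReflection_simple j, ?_⟩
      rw [wordProd_append, ← hωw]; omega
    obtain ⟨k, hk, hk'⟩ := hinv.exists_eraseIdx
    rw [List.length_append] at hk
    rcases lt_or_ge k ω.length with hkω | hkω
    · rw [List.eraseIdx_append_of_lt_length hkω, wordProd_append, wordProd_append, ← hωw] at hk'
      have h1 : w * (cs.wordProd ν * cs.simple j * (cs.wordProd ν)⁻¹) =
          cs.wordProd (ω.eraseIdx k) := by
        rw [← mul_assoc, ← mul_assoc, hk', mul_inv_cancel_right]
      have h2 := hw _ (mul_mem (mul_mem (cs.wordProd_mem_parabolic hνJ)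
        (cs.simple_mem_parabolic hj)) (inv_mem (cs.wordProd_mem_parabolic hνJ)))
      rw [h1] at h2
      have h3 := cs.length_wordProd_le (ω.eraseIdx k)
      have := List.length_eraseIdx_add_one hkω
      omega
    · rw [List.eraseIdx_append_of_length_le hkω, wordProd_append, wordProd_append, mul_assoc,
        mul_left_cancel_iff] at hk'
      have h1 := hmin (ν.eraseIdx (k - ω.length)) (fun i hi => hνJ i (List.mem_of_mem_eraseIdx hi))
        (by rw [← hk', wordProd_append, wordProd_singleton])
      have := List.length_eraseIdx_add_one (l := ν) (i := k - ω.length) (by omega)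
      simp at h1
      omega

lemma isMinRep_one : cs.IsMinRep J 1 := fun x _ => by simp

variable (cs) in
/-- Elements of a parabolic subgroup `W_J` have reduced words with letters in `J`. -/
theorem exists_isReduced_of_mem_parabolic {x : W} (hx : x ∈ cs.parabolic J) :
    ∃ ν : List B, (∀ j ∈ ν, j ∈ J) ∧ cs.IsReduced ν ∧ cs.wordProd ν = x ∧
      ∀ w, cs.IsMinRep J w → cs.length (w * x) = cs.length w + ν.length := by
  classical
  have hex : ∃ n, ∃ ν : List B, (∀ j ∈ ν, j ∈ J) ∧ cs.wordProd ν = x ∧ ν.length = n := by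
    obtain ⟨ν, h1, h2⟩ := cs.exists_word_of_mem_parabolic hx
    exact ⟨_, ν, h1, h2, rfl⟩
  obtain ⟨ν, h1, rfl, h3⟩ := Nat.find_spec hex
  have key : ∀ w, cs.IsMinRep J w →
      cs.length (w * cs.wordProd ν) = cs.length w + ν.length := fun w hw =>
    hw.length_mul_wordProd h1 fun μ hμ h => h3.le.trans (Nat.find_min' hex ⟨μ, hμ, h, rfl⟩)
  exact ⟨ν, h1, by simpa [IsReduced] using key 1 isMinRep_one, rfl, key⟩

theorem IsMinRep.length_mul {w x : W} (hw : cs.IsMinRep J w) (hx : x ∈ cs.parabolic J) :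
    cs.length (w * x) = cs.length w + cs.length x := by
  obtain ⟨ν, -, h2, rfl, h4⟩ := cs.exists_isReduced_of_mem_parabolic hx
  rw [h4 w hw, h2.eq]

theorem IsMinRep.eq_of_mk_eq {u v : W} (hu : cs.IsMinRep J u) (hv : cs.IsMinRep J v)
    (h : (u : W ⧸ cs.parabolic J) = v) : u = v := by
  have hx := QuotientGroup.eq.1 h
  have h1 := hu.length_mul hx
  have h2 := hv _ (inv_mem hx)
  simp only [mul_inv_rev, inv_inv, mul_inv_cancel_left] at h1 h2
  have h0 : cs.length (u⁻¹ * v) = 0 := by omega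
  rw [length_eq_zero_iff, inv_mul_eq_one] at h0
  exact h0

variable (cs) in
lemma exists_isMinRep (J : Set B) (w : W) :
    ∃ u, cs.IsMinRep J u ∧ ∃ x ∈ cs.parabolic J, w = u * x := by
  classical
  have hex : ∃ n, ∃ x ∈ cs.parabolic J, cs.length (w * x) = n := ⟨_, 1, one_mem _, rfl⟩
  obtain ⟨x, hx, hxn⟩ := Nat.find_spec hex
  refine ⟨w * x, fun y hy => ?_, x⁻¹, inv_mem hx, by simp⟩
  rw [hxn, mul_assoc]
  exact Nat.find_min' hex ⟨x * y, mul_mem hx hy, rfl⟩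

/-- Factor `w` through its minimal representative: the last letter of a reduced `J`-word for the
other factor would be a descent of `w` in `J`. -/
theorem isMinRep_of_forall_simple {w : W}
    (h : ∀ j ∈ J, cs.length w < cs.length (w * cs.simple j)) : cs.IsMinRep J w := by
  obtain ⟨u, hu, x, hx, rfl⟩ := cs.exists_isMinRep J w
  obtain ⟨ν, h1, h2, rfl, h4⟩ := cs.exists_isReduced_of_mem_parabolic hx
  rcases List.eq_nil_or_concat ν with rfl | ⟨μ, j, rfl⟩
  · simpa using hu
  · exfalso
    have h5 := h j (h1 j (by simp))
    have h6 := cs.length_mul_le u (cs.wordProd μ)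
    have h7 := cs.length_wordProd_le μ
    rw [h4 u hu, wordProd_concat, ← mul_assoc, simple_mul_simple_cancel_right] at h5
    simp at h5
    omega

lemma IsMinRep.length_mul_simple {w : W} (hw : cs.IsMinRep J w) {j : B} (hj : j ∈ J) :
    cs.length (w * cs.simple j) = cs.length w + 1 := by
  simpa using hw.length_mul (cs.simple_mem_parabolic hj)

variable (cs) in
lemma isMinRep_simple {s : B} (hs : s ∉ J) : cs.IsMinRep J (cs.simple s) := by
  intro x hx
  rw [length_simple, Nat.one_le_iff_ne_zero, ne_eq, length_eq_zero_iff]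
  intro h
  rw [mul_eq_one_iff_eq_inv] at h
  exact hs (cs.simple_mem_parabolic_iff.1 (h ▸ inv_mem hx))

variable (cs) in
lemma length_simple_mul_of_mem_parabolic {t : B} (ht : t ∉ J) {x : W}
    (hx : x ∈ cs.parabolic J) : cs.length (cs.simple t * x) = cs.length x + 1 := by
  rw [(cs.isMinRep_simple ht).length_mul hx, length_simple, add_comm]

variable (cs) in
lemma length_mul_simple_of_mem_parabolic {t : B} (ht : t ∉ J) {x : W}
    (hx : x ∈ cs.parabolic J) : cs.length (x * cs.simple t) = cs.length x + 1 := by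
  rw [← length_inv, mul_inv_rev, inv_simple,
    cs.length_simple_mul_of_mem_parabolic ht (inv_mem hx), length_inv]

variable (cs) in
-- Multiplying $tjt\in W_J$ by $t\notin J$ raises the length, yet gives $jt$, of length at most 2.
-- So $tjt$ is a generator; it lies in $J$ and in $\{t,j\}$, hence equals $j$.
lemma comm_of_conj_simple_mem_parabolic {t j : B} (ht : t ∉ J) (hjt : j ≠ t)
    (h : cs.simple t * cs.simple j * cs.simple t ∈ cs.parabolic J) :
    cs.simple t * cs.simple j = cs.simple j * cs.simple t := by
  have h1 := cs.length_simple_mul_of_mem_parabolic ht h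
  have h2 := cs.length_mul_le (cs.simple j) (cs.simple t)
  rw [mul_assoc, simple_mul_simple_cancel_left] at h1
  rw [length_simple, length_simple] at h2
  have hne : cs.simple t * (cs.simple j * cs.simple t) ≠ 1 := by
    intro h3
    rw [mul_eq_one_iff_inv_eq, inv_simple] at h3
    exact cs.length_simple_mul_ne (cs.simple t) j (by rw [← h3])
  have h3 : cs.length (cs.simple t * (cs.simple j * cs.simple t)) = 1 := by
    have := cs.length_eq_zero_iff.not.2 hne
    omega
  obtain ⟨r, hr⟩ := cs.length_eq_one_iff.1 h3
  have hrJ : r ∈ J := by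
    rw [mul_assoc, hr] at h
    exact cs.simple_mem_parabolic_iff.1 h
  have hr' : r ∈ ({t, j} : Set B) := by
    rw [← cs.simple_mem_parabolic_iff, ← hr]
    exact mul_mem (cs.simple_mem_parabolic (by simp)) (mul_mem (cs.simple_mem_parabolic (by simp))
      (cs.simple_mem_parabolic (by simp)))
  rcases hr' with rfl | hr'
  · exact absurd hrJ ht
  · rw [Set.mem_singleton_iff] at hr'
    subst hr'
    nth_rw 2 [← hr]
    simp [mul_assoc]

/-- If $j\in J$ were a descent of $at$, exchange would give $tjt\in W_I$, so $t$ and $j$ commute.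
Then $atj=ajt$ has length $\ell(a)+2$, a contradiction. -/
lemma IsMinRep.mul_simple {I : Set B} {a : W} (ha : cs.IsMinRep J a)
    (haI : a ∈ cs.parabolic I) {t : B} (htI : t ∉ I) (htJ : t ∉ J) :
    cs.IsMinRep J (a * cs.simple t) := by
  refine isMinRep_of_forall_simple fun j hj => ?_
  by_contra hlt
  have hjt : j ≠ t := by rintro rfl; exact htJ hj
  have hne := cs.length_mul_simple_ne (a * cs.simple t) j
  obtain ⟨ω, hωI, -, rfl, -⟩ := cs.exists_isReduced_of_mem_parabolic haI
  have hinv : cs.IsRightInversion (cs.wordProd (ω ++ [t])) (cs.simple j) := by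
    refine ⟨cs.isReflection_simple j, ?_⟩
    rw [wordProd_append, wordProd_singleton]; omega
  have hcomm : cs.simple t * cs.simple j = cs.simple j * cs.simple t := by
    obtain ⟨k, hk, hk'⟩ := hinv.exists_eraseIdx
    rw [List.length_append, List.length_singleton] at hk
    rcases lt_or_ge k ω.length with hkω | hkω
    · rw [List.eraseIdx_append_of_lt_length hkω, wordProd_append, wordProd_append] at hk'
      refine cs.comm_of_conj_simple_mem_parabolic htI hjt ?_
      have : cs.simple t * cs.simple j * cs.simple t =
          (cs.wordProd ω)⁻¹ * cs.wordProd (ω.eraseIdx k) := by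
        rw [eq_inv_mul_iff_mul_eq]
        simpa [mul_assoc] using congrArg (· * cs.simple t) hk'
      rw [this]
      exact mul_mem (inv_mem haI)
        (cs.wordProd_mem_parabolic fun i hi => hωI i (List.mem_of_mem_eraseIdx hi))
    · have : k = ω.length := by omega
      subst this
      rw [List.eraseIdx_append_of_length_le le_rfl, wordProd_append, wordProd_append] at hk'
      simp only [wordProd_singleton, mul_assoc, le_refl, tsub_eq_zero_of_le, List.eraseIdx_cons_zero,
        wordProd_nil, mul_one, mul_eq_left] at hk'
      rw [mul_eq_one_iff_eq_inv, inv_simple] at hk'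
      exact absurd (cs.simple_injective hk').symm hjt
  have h1 : cs.length (cs.wordProd ω * cs.simple j * cs.simple t) =
      cs.length (cs.wordProd ω) + 1 + 1 := by
    rw [cs.length_mul_simple_of_mem_parabolic (J := insert j I) (by simp [htI, hjt.symm]),
      ha.length_mul_simple hj]
    exact mul_mem (cs.parabolic_mono (Set.subset_insert j I) haI)
      (cs.simple_mem_parabolic (Set.mem_insert j I))
  rw [mul_assoc, ← hcomm, ← mul_assoc] at h1
  have := cs.length_mul_simple_of_mem_parabolic htI haI
  omega

/-- For $j\ne t$, the element $aj$ avoids the letter $t$, so $t(aj)$ is longer still. If $j=t$ were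
a descent of $ta$, exchange would give either $ta=at$ or $t\in W_I$. -/
lemma IsMinRep.simple_mul {I : Set B} {a : W} (ha : cs.IsMinRep J a)
    (haI : a ∈ cs.parabolic I) {t : B} (htI : t ∉ I)
    (ht : t ∈ J → cs.simple t * a ≠ a * cs.simple t) :
    cs.IsMinRep J (cs.simple t * a) := by
  refine isMinRep_of_forall_simple fun j hj => ?_
  rw [cs.length_simple_mul_of_mem_parabolic htI haI]
  rcases eq_or_ne j t with rfl | hjt
  · by_contra hlt
    have hne := cs.length_mul_simple_ne (cs.simple j * a) j
    rw [cs.length_simple_mul_of_mem_parabolic htI haI] at hne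
    obtain ⟨ω, hωI, -, rfl, -⟩ := cs.exists_isReduced_of_mem_parabolic haI
    have hinv : cs.IsRightInversion (cs.wordProd (j :: ω)) (cs.simple j) := by
      refine ⟨cs.isReflection_simple j, ?_⟩
      rw [wordProd_cons, cs.length_simple_mul_of_mem_parabolic htI haI]; omega
    obtain ⟨k, -, hk⟩ := hinv.exists_eraseIdx
    rw [wordProd_cons] at hk
    rcases k with _ | k
    · rw [List.eraseIdx_cons_zero] at hk
      apply ht hj
      nth_rw 2 [← hk]
      simp
    · rw [List.eraseIdx_cons_succ, wordProd_cons, mul_assoc, mul_left_cancel_iff] at hk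
      have h1 : cs.simple j = (cs.wordProd ω)⁻¹ * cs.wordProd (ω.eraseIdx k) := by
        rw [← hk]; simp
      apply htI
      rw [← cs.simple_mem_parabolic_iff, h1]
      exact mul_mem (inv_mem haI)
        (cs.wordProd_mem_parabolic fun i hi => hωI i (List.mem_of_mem_eraseIdx hi))
  · have h1 : a * cs.simple j ∈ cs.parabolic (insert j I) :=
      mul_mem (cs.parabolic_mono (Set.subset_insert j I) haI)
        (cs.simple_mem_parabolic (Set.mem_insert j I))
    rw [mul_assoc, cs.length_simple_mul_of_mem_parabolic (J := insert j I)
      (by simp [htI, hjt.symm]) h1, ha.length_mul_simple hj]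
    omega

end Parabolic

/-! ### The Bruhat order on minimal representatives -/

section Bruhat

variable {cs}

lemma BruhatLE.refl (u : W) : cs.BruhatLE u u := Relation.ReflTransGen.refl

lemma BruhatLE.trans {u v w : W} (h : cs.BruhatLE u v) (h' : cs.BruhatLE v w) :
    cs.BruhatLE u w := Relation.ReflTransGen.trans h h'

lemma BruhatLE.length_lt_or_eq {u v : W} (h : cs.BruhatLE u v) :
    cs.length u < cs.length v ∨ u = v := by
  induction h with
  | refl => exact Or.inr rfl
  | tail _ h ih =>
    obtain ⟨t, -, rfl, h⟩ := h
    rcases ih with h' | rfl <;> left <;> omega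

lemma BruhatLE.length_le {u v : W} (h : cs.BruhatLE u v) : cs.length u ≤ cs.length v := by
  rcases h.length_lt_or_eq with h | rfl
  exacts [h.le, le_rfl]

lemma BruhatLE.eq_of_length_le {u v : W} (h : cs.BruhatLE u v)
    (h' : cs.length v ≤ cs.length u) : u = v :=
  h.length_lt_or_eq.resolve_left h'.not_gt

lemma BruhatLE.antisymm {u v : W} (h : cs.BruhatLE u v) (h' : cs.BruhatLE v u) : u = v :=
  h.eq_of_length_le h'.length_le

lemma bruhatLE_mul_simple {w : W} {i : B} (h : cs.length w < cs.length (w * cs.simple i)) :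
    cs.BruhatLE w (w * cs.simple i) :=
  Relation.ReflTransGen.single ⟨cs.simple i, cs.isReflection_simple i, rfl, h⟩

lemma bruhatLE_simple_mul {w : W} {i : B} (h : cs.length w < cs.length (cs.simple i * w)) :
    cs.BruhatLE w (cs.simple i * w) :=
  Relation.ReflTransGen.single ⟨w⁻¹ * cs.simple i * w, ⟨w⁻¹, i, by simp⟩, by group, h⟩

lemma bruhatLE_wordProd_append {μ ν : List B} (h : cs.IsReduced (μ ++ ν)) :
    cs.BruhatLE (cs.wordProd ν) (cs.wordProd (μ ++ ν)) := by
  induction μ with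
  | nil => exact .refl _
  | cons i μ ih =>
    have h1 : cs.IsReduced (μ ++ ν) := by simpa using h.drop 1
    refine (ih h1).trans ?_
    rw [List.cons_append, wordProd_cons]
    apply bruhatLE_simple_mul
    rw [← wordProd_cons, h1.eq, ← List.cons_append, h.eq]
    simp

lemma wordProd_bruhatLE_append {μ ν : List B} (h : cs.IsReduced (μ ++ ν)) :
    cs.BruhatLE (cs.wordProd μ) (cs.wordProd (μ ++ ν)) := by
  induction ν using List.reverseRecOn with
  | nil => simpa using .refl _
  | append_singleton ν i ih =>
    rw [← List.append_assoc] at h ⊢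
    have h1 : cs.IsReduced (μ ++ ν) := by
      have := h.take (μ ++ ν).length
      rwa [List.take_left] at this
    refine (ih h1).trans ?_
    rw [wordProd_append cs (μ ++ ν), wordProd_singleton]
    apply bruhatLE_mul_simple
    rw [← wordProd_singleton, ← wordProd_append, h1.eq, h.eq]
    simp

lemma one_bruhatLE (w : W) : cs.BruhatLE 1 w := by
  obtain ⟨ω, hω, rfl⟩ := cs.exists_isReduced w
  simpa using bruhatLE_wordProd_append (cs := cs) (μ := ω) (ν := []) (by simpa using hω)

lemma simple_bruhatLE_of_isRightDescent {w : W} {i : B} (h : cs.IsRightDescent w i) :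
    cs.BruhatLE (cs.simple i) w := by
  obtain ⟨ω, hω, hw⟩ := cs.exists_isReduced (w * cs.simple i)
  have h1 : w = cs.wordProd (ω ++ [i]) := by
    rw [wordProd_append, ← hw]; simp
  have h2 : cs.IsReduced (ω ++ [i]) := by
    rw [IsReduced, ← h1, List.length_append, ← hω.eq, ← hw, ← cs.isRightDescent_iff.1 h]
    simp
  simpa [h1] using bruhatLE_wordProd_append h2

lemma simple_bruhatLE_simple_mul {w : W} {i : B} (h : cs.length w < cs.length (cs.simple i * w)) :
    cs.BruhatLE (cs.simple i) (cs.simple i * w) := by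
  obtain ⟨ω, hω, rfl⟩ := cs.exists_isReduced w
  have h2 : cs.IsReduced ([i] ++ ω) := by
    rw [IsReduced, wordProd_append, wordProd_singleton]
    have := cs.length_simple_mul (cs.wordProd ω) i
    rw [hω.eq] at this h
    simp only [List.singleton_append, List.length_cons]
    omega
  simpa [wordProd_cons] using wordProd_bruhatLE_append h2

/-- By strong exchange each downward step deletes a letter from a word in `I`. -/
lemma BruhatLE.mem_parabolic {I : Set B} {u v : W} (h : cs.BruhatLE u v)
    (hv : v ∈ cs.parabolic I) : u ∈ cs.parabolic I := by
  induction h using Relation.ReflTransGen.head_induction_on with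
  | refl => exact hv
  | head h _ ih =>
    obtain ⟨t, ht, rfl, hlt⟩ := h
    obtain ⟨ω, hωI, -, hω, -⟩ := cs.exists_isReduced_of_mem_parabolic ih
    have hinv : cs.IsRightInversion (cs.wordProd ω) t := by
      refine ⟨ht, ?_⟩
      rwa [hω, mul_assoc, ht.mul_self, mul_one]
    obtain ⟨k, -, hk⟩ := hinv.exists_eraseIdx
    rw [hω, mul_assoc, ht.mul_self, mul_one] at hk
    rw [hk]
    exact cs.wordProd_mem_parabolic fun i hi => hωI i (List.mem_of_mem_eraseIdx hi)

/-- The Bruhat order on the representatives of minimal length is the order on `W / W_J`. -/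
lemma quotientLE_mk_iff {J : Set B} {u v : W} (hu : cs.IsMinRep J u) (hv : cs.IsMinRep J v) :
    cs.QuotientLE J (u : W ⧸ cs.parabolic J) v ↔ cs.BruhatLE u v := by
  constructor
  · rintro ⟨u', v', hu', hv', h1, h2, h3⟩
    rwa [hu'.eq_of_mk_eq hu h1, hv'.eq_of_mk_eq hv h2] at h3
  · exact fun h => ⟨u, v, hu, hv, rfl, rfl, h⟩

/-- The Bruhat order restricted to the elements of `W_I` of minimal length in their coset of `W_J`. -/
def MinRepLE (cs : CoxeterSystem M W) (J I : Set B) :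
    {w : W // cs.IsMinRep J w ∧ w ∈ cs.parabolic I} →
    {w : W // cs.IsMinRep J w ∧ w ∈ cs.parabolic I} → Prop :=
  fun u v => cs.BruhatLE u v

/-- `W / W_J` is isomorphic to the Bruhat order on the representatives of minimal length. -/
noncomputable def quotientIso (cs : CoxeterSystem M W) (J : Set B) :
    cs.MinRepLE J Set.univ ≃r cs.QuotientLE J where
  toEquiv := Equiv.ofBijective (fun w => (w.1 : W ⧸ cs.parabolic J)) (by
    constructor
    · intro u v h
      exact Subtype.ext (u.2.1.eq_of_mk_eq v.2.1 h)
    · intro x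
      obtain ⟨w, rfl⟩ := QuotientGroup.mk_surjective x
      obtain ⟨u, hu, y, hy, rfl⟩ := cs.exists_isMinRep J w
      refine ⟨⟨u, hu, by simp [parabolic_univ]⟩, ?_⟩
      exact QuotientGroup.eq.2 (by simpa using hy))
  map_rel_iff' {u v} := quotientLE_mk_iff u.2.1 v.2.1

end Bruhat

end CoxeterSystem

/-! ### Unions of components, retractions and the product decomposition -/

namespace CoxeterMatrix

variable {B : Type*} {M : CoxeterMatrix B}

/-- A set of generators is saturated if it is a union of connected components of the Coxeter graph,
that is, if its elements commute with all generators outside it. -/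
def IsSaturated (M : CoxeterMatrix B) (C : Set B) : Prop := ∀ s ∈ C, ∀ t ∉ C, M s t = 2

lemma IsSaturated.compl {C : Set B} (h : M.IsSaturated C) : M.IsSaturated Cᶜ := by
  intro s hs t ht
  rw [M.symmetric]
  exact h t (by simpa using ht) s hs

lemma isSaturated_iUnion {ι : Sort*} {P : ι → Set B} (h : ∀ i, M.IsSaturated (P i)) :
    M.IsSaturated (⋃ i, P i) := by
  intro s hs t ht
  simp only [Set.mem_iUnion, not_exists] at hs ht
  obtain ⟨i, hi⟩ := hs
  exact h i s hi t (ht i)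

lemma isSaturated_univ : M.IsSaturated Set.univ := fun _ _ _ h => absurd (Set.mem_univ _) h

lemma isSaturated_empty : M.IsSaturated ∅ := fun _ h => absurd h (Set.notMem_empty _)

lemma IsDisjointUnion.isSaturated {n : ℕ} {P : Fin n → Set B} (h : M.IsDisjointUnion P)
    (i : Fin n) : M.IsSaturated (P i) := by
  intro s hs t ht
  obtain ⟨j, hj⟩ := Set.mem_iUnion.1 (h.cover.ge (Set.mem_univ t))
  have hij : i ≠ j := by rintro rfl; exact ht hj
  by_contra hne
  exact h.no_edge i j hij s hs t hj ⟨by rintro rfl; exact ht hs, hne⟩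

end CoxeterMatrix

namespace CoxeterSystem

open CoxeterMatrix

variable {B W : Type*} [Group W] {M : CoxeterMatrix B} (cs : CoxeterSystem M W)

open Classical in
lemma isLiftable_ite {G : Type*} [Group G] {f : B → G} {C : Set B} (hC : M.IsSaturated C)
    (hf : ∀ s ∈ C, ∀ t ∈ C, (f s * f t) ^ M s t = 1) :
    M.IsLiftable (fun s => if s ∈ C then f s else 1) := by
  have hsq : ∀ s ∈ C, f s ^ 2 = 1 := fun s hs => by
    simpa [pow_two] using hf s hs s hs
  intro s t
  by_cases hs : s ∈ C <;> by_cases ht : t ∈ C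
  · simpa [hs, ht] using hf s hs t ht
  · simp [hs, ht, hC s hs t ht, hsq]
  · simp [hs, ht, M.symmetric s t, hC t ht s hs, hsq]
  · simp [hs, ht]

open Classical in
/-- The retraction of `W` onto `W_C` which kills the generators outside the saturated set `C`. -/
noncomputable def retraction (C : Set B) : W →* W :=
  if h : M.IsSaturated C then
    cs.lift ⟨_, isLiftable_ite h fun s _ t _ => cs.simple_mul_simple_pow s t⟩
  else 1

section Retraction

variable {cs} {C D : Set B}

lemma retraction_simple_of_mem (hC : M.IsSaturated C) {s : B} (hs : s ∈ C) :
    cs.retraction C (cs.simple s) = cs.simple s := by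
  rw [retraction, dif_pos hC, lift_apply_simple, if_pos hs]

lemma retraction_simple_of_notMem (hC : M.IsSaturated C) {s : B} (hs : s ∉ C) :
    cs.retraction C (cs.simple s) = 1 := by
  rw [retraction, dif_pos hC, lift_apply_simple, if_neg hs]

lemma retraction_mem_parabolic_inter (hC : M.IsSaturated C) {J : Set B} {w : W}
    (hw : w ∈ cs.parabolic J) : cs.retraction C w ∈ cs.parabolic (J ∩ C) := by
  have : cs.parabolic J ≤ (cs.parabolic (J ∩ C)).comap (cs.retraction C) := by
    rw [parabolic, Subgroup.closure_le]
    rintro _ ⟨s, hs, rfl⟩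
    by_cases h : s ∈ C
    · simpa [retraction_simple_of_mem hC h] using cs.simple_mem_parabolic (J := J ∩ C) ⟨hs, h⟩
    · simp [retraction_simple_of_notMem hC h, one_mem]
  exact this hw

lemma retraction_mem (hC : M.IsSaturated C) (w : W) : cs.retraction C w ∈ cs.parabolic C := by
  simpa using retraction_mem_parabolic_inter hC (J := Set.univ) (w := w) (by simp [parabolic_univ])

lemma retraction_mem_of_mem (hC : M.IsSaturated C) {J : Set B} {w : W}
    (hw : w ∈ cs.parabolic J) : cs.retraction C w ∈ cs.parabolic J :=
  cs.parabolic_mono Set.inter_subset_left (retraction_mem_parabolic_inter hC hw)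

lemma retraction_eq_self (hC : M.IsSaturated C) {w : W} (hw : w ∈ cs.parabolic C) :
    cs.retraction C w = w := by
  have : cs.parabolic C ≤ (cs.retraction C).eqLocus (MonoidHom.id W) := by
    rw [parabolic, Subgroup.closure_le]
    rintro _ ⟨s, hs, rfl⟩
    exact retraction_simple_of_mem hC hs
  exact this hw

lemma retraction_eq_one (hC : M.IsSaturated C) (h : Disjoint C D) {w : W}
    (hw : w ∈ cs.parabolic D) : cs.retraction C w = 1 := by
  have := retraction_mem_parabolic_inter hC hw
  rwa [h.symm.inter_eq, parabolic_empty, Subgroup.mem_bot] at this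

lemma parabolic_commute (hC : M.IsSaturated C) (h : Disjoint C D) {x y : W}
    (hx : x ∈ cs.parabolic C) (hy : y ∈ cs.parabolic D) : x * y = y * x := by
  have hst : ∀ s ∈ C, ∀ t ∈ D, cs.simple s * cs.simple t = cs.simple t * cs.simple s :=
    fun s hs t ht => (cs.simple_mul_comm_iff (h.ne_of_mem hs ht)).2
      (hC s hs t (h.notMem_of_mem_right ht))
  have h1 : ∀ s ∈ C, ∀ y ∈ cs.parabolic D, cs.simple s * y = y * cs.simple s := by
    intro s hs y hy
    have : cs.parabolic D ≤ Subgroup.centralizer {cs.simple s} := by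
      rw [parabolic, Subgroup.closure_le]
      rintro _ ⟨t, ht, rfl⟩
      simpa [Subgroup.mem_centralizer_iff] using hst s hs t ht
    simpa [Subgroup.mem_centralizer_iff] using this hy
  have : cs.parabolic C ≤ Subgroup.centralizer {y} := by
    rw [parabolic, Subgroup.closure_le]
    rintro _ ⟨s, hs, rfl⟩
    simpa [Subgroup.mem_centralizer_iff] using (h1 s hs y hy).symm
  simpa [Subgroup.mem_centralizer_iff, eq_comm] using this hx

lemma retraction_union (hC : M.IsSaturated C) (hD : M.IsSaturated D) (h : Disjoint C D) (w : W) :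
    cs.retraction (C ∪ D) w = cs.retraction C w * cs.retraction D w := by
  have hCD : M.IsSaturated (C ∪ D) := by
    rw [Set.union_eq_iUnion]
    exact isSaturated_iUnion (by simp [hC, hD])
  induction w using cs.simple_induction_left with
  | one => simp
  | mul_simple_left w i ih =>
    simp only [map_mul, ih]
    by_cases hiC : i ∈ C
    · rw [retraction_simple_of_mem hCD (Or.inl hiC), retraction_simple_of_mem hC hiC,
        retraction_simple_of_notMem hD (h.notMem_of_mem_left hiC)]
      simp [mul_assoc]
    · by_cases hiD : i ∈ D
      · rw [retraction_simple_of_mem hCD (Or.inr hiD), retraction_simple_of_notMem hC hiC,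
          retraction_simple_of_mem hD hiD, one_mul, ← mul_assoc, ← mul_assoc,
          parabolic_commute hD h.symm (cs.simple_mem_parabolic hiD) (retraction_mem hC w)]
      · rw [retraction_simple_of_notMem hCD (by simp [hiC, hiD]),
          retraction_simple_of_notMem hC hiC, retraction_simple_of_notMem hD hiD]
        simp

lemma retraction_univ (w : W) : cs.retraction Set.univ w = w :=
  retraction_eq_self isSaturated_univ (by simp [parabolic_univ])

lemma retraction_mul_retraction_compl (hC : M.IsSaturated C) (w : W) :
    cs.retraction C w * cs.retraction Cᶜ w = w := by
  rw [← retraction_union hC hC.compl disjoint_compl_right, Set.union_compl_self, retraction_univ]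

/-- Each letter of a reduced word survives in exactly one of the two projections, which bounds the
sum above; `w` is the product of its projections, which bounds it below. -/
lemma length_retraction_add (hC : M.IsSaturated C) (w : W) :
    cs.length (cs.retraction C w) + cs.length (cs.retraction Cᶜ w) = cs.length w := by
  apply le_antisymm
  · obtain ⟨ω, hω, rfl⟩ := cs.exists_isReduced w
    rw [hω.eq]
    clear hω
    induction ω with
    | nil => simp
    | cons i ω ih =>
      rw [wordProd_cons, map_mul, map_mul, List.length_cons]
      by_cases hi : i ∈ C
      · rw [retraction_simple_of_mem hC hi, retraction_simple_of_notMem hC.compl (by simpa), one_mul]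
        have := cs.length_mul_le (cs.simple i) (cs.retraction C (cs.wordProd ω))
        rw [length_simple] at this
        omega
      · rw [retraction_simple_of_notMem hC hi, retraction_simple_of_mem hC.compl hi, one_mul]
        have := cs.length_mul_le (cs.simple i) (cs.retraction Cᶜ (cs.wordProd ω))
        rw [length_simple] at this
        omega
  · conv_lhs => rw [← retraction_mul_retraction_compl (cs := cs) hC w]
    exact cs.length_mul_le _ _

lemma length_mul_of_disjoint (hC : M.IsSaturated C) (h : Disjoint C D) {x y : W}
    (hx : x ∈ cs.parabolic C) (hy : y ∈ cs.parabolic D) :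
    cs.length (x * y) = cs.length x + cs.length y := by
  have hy' : y ∈ cs.parabolic Cᶜ := cs.parabolic_mono h.subset_compl_left hy
  rw [← length_retraction_add hC, map_mul, map_mul, retraction_eq_self hC hx,
    retraction_eq_one hC h hy, retraction_eq_one hC.compl disjoint_compl_left hx,
    retraction_eq_self hC.compl hy', mul_one, one_mul]

/-- Multiplying on the right by an element of a complementary parabolic subgroup, and projecting
to `W_C`, preserve the Bruhat order. -/
lemma BruhatLE.retraction_mul (hC : M.IsSaturated C) (h : Disjoint C D) {u v z : W}
    (huv : cs.BruhatLE u v) (hz : z ∈ cs.parabolic D) :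
    cs.BruhatLE (cs.retraction C u * z) (cs.retraction C v * z) := by
  induction huv with
  | refl => exact .refl _
  | tail _ hbc ih =>
    refine ih.trans ?_
    rename_i b c _
    obtain ⟨t, ⟨x, s, rfl⟩, rfl, hlt⟩ := hbc
    -- A reflection conjugate to $s$ is killed by exactly one of the two retractions. If $s\in C$,
    -- the complementary component is unchanged, so the whole length increase happens in $W_C$;
    -- otherwise the projection to $W_C$ does not move.
    by_cases hs : s ∈ C
    · have hcompl : cs.retraction Cᶜ (x * cs.simple s * x⁻¹) = 1 := by
        simp [retraction_simple_of_notMem hC.compl (show s ∉ Cᶜ by simpa)]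
      have ht : cs.IsReflection (cs.retraction C (x * cs.simple s * x⁻¹)) :=
        ⟨cs.retraction C x, s, by simp [retraction_simple_of_mem hC hs]⟩
      refine Relation.ReflTransGen.single ⟨_, ht, ?_, ?_⟩
      · rw [map_mul _ b, mul_assoc (cs.retraction C b),
          parabolic_commute hC h (retraction_mem hC _) hz, ← mul_assoc]
      · rw [length_mul_of_disjoint hC h (retraction_mem hC _) hz,
          length_mul_of_disjoint hC h (retraction_mem hC _) hz]
        have h1 := length_retraction_add (cs := cs) hC b
        have h2 := length_retraction_add (cs := cs) hC (b * (x * cs.simple s * x⁻¹))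
        rw [map_mul (cs.retraction Cᶜ) b, hcompl, mul_one] at h2
        omega
    · have : cs.retraction C (x * cs.simple s * x⁻¹) = 1 := by
        simp [retraction_simple_of_notMem hC hs]
      rw [map_mul _ b, this, mul_one]
      exact .refl _

lemma BruhatLE.retraction (hC : M.IsSaturated C) {u v : W} (huv : cs.BruhatLE u v) :
    cs.BruhatLE (cs.retraction C u) (cs.retraction C v) := by
  simpa using huv.retraction_mul hC disjoint_compl_right (one_mem (cs.parabolic Cᶜ))

/-- The factors commute, so one can be raised at a time: $xy\le x'y\le x'y'$. -/
lemma BruhatLE.mul_of_disjoint (hC : M.IsSaturated C) (hD : M.IsSaturated D) (h : Disjoint C D)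
    {x x' y y' : W} (hx : x ∈ cs.parabolic C) (hx' : x' ∈ cs.parabolic C)
    (hy : y ∈ cs.parabolic D) (hy' : y' ∈ cs.parabolic D)
    (hxx' : cs.BruhatLE x x') (hyy' : cs.BruhatLE y y') : cs.BruhatLE (x * y) (x' * y') := by
  have h1 := hxx'.retraction_mul hC h hy
  have h2 := hyy'.retraction_mul hD h.symm hx'
  rw [retraction_eq_self hC hx, retraction_eq_self hC hx'] at h1
  rw [retraction_eq_self hD hy, retraction_eq_self hD hy', ← parabolic_commute hC h hx' hy,
    ← parabolic_commute hC h hx' hy'] at h2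
  exact h1.trans h2

lemma bruhatLE_retraction_union (hC : M.IsSaturated C) (hD : M.IsSaturated D)
    (h : Disjoint C D) {u v : W}
    (h1 : cs.BruhatLE (cs.retraction C u) (cs.retraction C v))
    (h2 : cs.BruhatLE (cs.retraction D u) (cs.retraction D v)) :
    cs.BruhatLE (cs.retraction (C ∪ D) u) (cs.retraction (C ∪ D) v) := by
  rw [retraction_union hC hD h, retraction_union hC hD h]
  exact BruhatLE.mul_of_disjoint hC hD h (retraction_mem hC _) (retraction_mem hC _)
    (retraction_mem hD _) (retraction_mem hD _) h1 h2

lemma IsMinRep.retraction (hC : M.IsSaturated C) {J : Set B} {w : W} (hw : cs.IsMinRep J w) :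
    cs.IsMinRep J (cs.retraction C w) := by
  intro x hx
  have h1 := hw _ (retraction_mem_of_mem hC hx)
  have h2 := length_retraction_add (cs := cs) hC (w * cs.retraction C x)
  have h3 := length_retraction_add (cs := cs) hC w
  have h4 := length_retraction_add (cs := cs) hC (cs.retraction C w * x)
  have h5 := retraction_eq_self hC (retraction_mem (cs := cs) hC w)
  have h6 := retraction_eq_self hC (retraction_mem (cs := cs) hC x)
  have h7 := retraction_eq_one hC.compl disjoint_compl_left (retraction_mem (cs := cs) hC x)
  rw [map_mul, map_mul, h6, h7, mul_one] at h2
  rw [map_mul, map_mul, h5] at h4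
  omega

lemma IsMinRep.mul_of_disjoint (hC : M.IsSaturated C) (h : Disjoint C D)
    {J : Set B} {x y : W} (hx : cs.IsMinRep J x) (hy : cs.IsMinRep J y)
    (hxC : x ∈ cs.parabolic C) (hyD : y ∈ cs.parabolic D) : cs.IsMinRep J (x * y) := by
  intro z hz
  rw [length_mul_of_disjoint hC h hxC hyD, ← length_retraction_add hC (x * y * z)]
  have hyD' : y ∈ cs.parabolic Cᶜ := cs.parabolic_mono h.subset_compl_left hyD
  simp only [map_mul, retraction_eq_self hC hxC, retraction_eq_one hC h hyD, mul_one,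
    retraction_eq_one hC.compl disjoint_compl_left hxC, one_mul, retraction_eq_self hC.compl hyD']
  exact add_le_add (hx _ (retraction_mem_of_mem hC hz)) (hy _ (retraction_mem_of_mem hC.compl hz))

end Retraction

section Product

variable {cs} {ι : Type*} {P : ι → Set B}

lemma bruhatLE_retraction_biUnion (hP : ∀ i, M.IsSaturated (P i))
    (hd : Pairwise (Function.onFun Disjoint P)) {u v : W}
    (h : ∀ i, cs.BruhatLE (cs.retraction (P i) u) (cs.retraction (P i) v)) (F : Finset ι) :
    cs.BruhatLE (cs.retraction (⋃ i ∈ F, P i) u) (cs.retraction (⋃ i ∈ F, P i) v) := by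
  classical
  induction F using Finset.induction_on with
  | empty =>
    rw [retraction_eq_one (D := Set.univ) (by simpa using isSaturated_empty) (by simp)
      (by simp [parabolic_univ])]
    exact one_bruhatLE _
  | insert i F hi ih =>
    rw [Finset.set_biUnion_insert]
    refine bruhatLE_retraction_union (hP i) (isSaturated_iUnion fun j => isSaturated_iUnion
      fun _ => hP j) ?_ (h i) ih
    simp only [Set.disjoint_iUnion_right]
    intro j hj
    exact hd (by rintro rfl; exact hi hj)

lemma exists_isMinRep_retraction_eq (hP : ∀ i, M.IsSaturated (P i))
    (hd : Pairwise (Function.onFun Disjoint P)) {J : Set B} {x : ι → W}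
    (hx : ∀ i, cs.IsMinRep J (x i)) (hxP : ∀ i, x i ∈ cs.parabolic (P i)) (F : Finset ι) :
    ∃ w, cs.IsMinRep J w ∧ w ∈ cs.parabolic (⋃ i ∈ F, P i) ∧
      ∀ i ∈ F, cs.retraction (P i) w = x i := by
  classical
  induction F using Finset.induction_on with
  | empty => exact ⟨1, isMinRep_one, one_mem _, by simp⟩
  | insert i F hi ih =>
    obtain ⟨w, hw, hwF, hw'⟩ := ih
    have hdisj : Disjoint (P i) (⋃ j ∈ F, P j) := by
      simp only [Set.disjoint_iUnion_right]
      intro j hj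
      exact hd (by rintro rfl; exact hi hj)
    refine ⟨x i * w, (hx i).mul_of_disjoint (hP i) hdisj hw (hxP i) hwF, ?_, ?_⟩
    · rw [Finset.set_biUnion_insert]
      exact mul_mem (cs.parabolic_mono Set.subset_union_left (hxP i))
        (cs.parabolic_mono Set.subset_union_right hwF)
    · intro j hj
      rw [map_mul]
      rcases Finset.mem_insert.1 hj with rfl | hjF
      · rw [retraction_eq_self (hP j) (hxP j), retraction_eq_one (hP j) hdisj hwF, mul_one]
      · have hij : j ≠ i := by rintro rfl; exact hi hjF
        rw [hw' j hjF, retraction_eq_one (hP j) (hd hij) (hxP i), one_mul]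

/-- The Bruhat order on representatives of minimal length decomposes as a product over a
decomposition of the Coxeter graph. -/
noncomputable def minRepProdIso [Finite ι] (hP : ∀ i, M.IsSaturated (P i))
    (hd : Pairwise (Function.onFun Disjoint P)) (hcover : ⋃ i, P i = Set.univ) (J : Set B) :
    cs.MinRepLE J Set.univ ≃r
      (fun f g : ∀ i, {w : W // cs.IsMinRep J w ∧ w ∈ cs.parabolic (P i)} =>
        ∀ i, cs.MinRepLE J (P i) (f i) (g i)) := by
  have hiff : ∀ u v : W, (∀ i, cs.BruhatLE (cs.retraction (P i) u) (cs.retraction (P i) v)) ↔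
      cs.BruhatLE u v := by
    cases nonempty_fintype ι
    refine fun u v => ⟨fun h => ?_, fun h i => h.retraction (hP i)⟩
    simpa [hcover, retraction_univ] using bruhatLE_retraction_biUnion hP hd h Finset.univ
  refine ⟨Equiv.ofBijective (fun w i => ⟨cs.retraction (P i) w.1, w.2.1.retraction (hP i),
    retraction_mem (hP i) _⟩) ⟨?_, ?_⟩, ?_⟩
  · intro u v h
    have h' : ∀ i, cs.retraction (P i) u.1 = cs.retraction (P i) v.1 := fun i =>
      congrArg Subtype.val (congrFun h i)
    -- Equal components give comparability both ways, so injectivity follows from antisymmetry.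
    exact Subtype.ext (((hiff _ _).1 fun i => h' i ▸ .refl _).antisymm
      ((hiff _ _).1 fun i => h' i ▸ .refl _))
  · intro f
    cases nonempty_fintype ι
    obtain ⟨w, hw, -, hw'⟩ := exists_isMinRep_retraction_eq hP hd (fun i => (f i).2.1)
      (fun i => (f i).2.2) Finset.univ
    exact ⟨⟨w, hw, by simp [parabolic_univ]⟩, funext fun i => Subtype.ext (hw' i (Finset.mem_univ i))⟩
  · intro u v
    exact hiff u.1 v.1

end Product

end CoxeterSystem

namespace CoxeterSystem

open CoxeterMatrix

variable {B W : Type*} [Group W] {M : CoxeterMatrix B} (cs : CoxeterSystem M W)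

/-! ### The restricted system $(W_C, C)$ -/

section Restriction

variable {C : Set B}

/-- The inclusion of the abstract Coxeter group of the restricted matrix. -/
noncomputable def restrictHom (C : Set B) : (M.restrict C).Group →* W :=
  (M.restrict C).toCoxeterSystem.lift
    ⟨fun s => cs.simple s, fun s t => cs.simple_mul_simple_pow s t⟩

lemma restrictHom_simple (s : C) :
    cs.restrictHom C ((M.restrict C).toCoxeterSystem.simple s) = cs.simple s :=
  lift_apply_simple _ _ s

lemma range_restrictHom : (cs.restrictHom C).range = cs.parabolic C := by
  rw [MonoidHom.range_eq_map, ← (M.restrict C).toCoxeterSystem.subgroup_closure_range_simple,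
    MonoidHom.map_closure, ← Set.range_comp, parabolic, Set.image_eq_range]
  congr 2
  ext s
  exact cs.restrictHom_simple s

/-- Since `C` is saturated, killing the generators outside `C` defines a homomorphism back from `W`,
which is a left inverse. -/
lemma restrictHom_injective (hC : M.IsSaturated C) :
    Function.Injective (cs.restrictHom C) := by
  classical
  let f : B → (M.restrict C).Group := fun s =>
    if h : s ∈ C then (M.restrict C).toCoxeterSystem.simple ⟨s, h⟩ else 1
  let g := cs.lift ⟨_, isLiftable_ite (f := f) hC (fun s hs t ht => by
    simp only [f, dif_pos hs, dif_pos ht]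
    exact (M.restrict C).toCoxeterSystem.simple_mul_simple_pow ⟨s, hs⟩ ⟨t, ht⟩)⟩
  have hg : g.comp (cs.restrictHom C) = MonoidHom.id _ := by
    apply (M.restrict C).toCoxeterSystem.ext_simple
    intro s
    rw [MonoidHom.comp_apply, restrictHom_simple]
    simp [g, lift_apply_simple, f]
  exact Function.LeftInverse.injective (g := g) fun x => DFunLike.congr_fun hg x

theorem exists_isRestriction (hC : M.IsSaturated C) :
    ∃ csC : CoxeterSystem (M.restrict C) (cs.parabolic C), cs.IsRestriction C csC := by
  let e : (M.restrict C).Group ≃* cs.parabolic C :=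
    (MonoidHom.ofInjective (cs.restrictHom_injective hC)).trans
      (MulEquiv.subgroupCongr cs.range_restrictHom)
  exact ⟨(M.restrict C).toCoxeterSystem.map e, fun s => cs.restrictHom_simple s⟩

namespace IsRestriction

variable {cs} {csC : CoxeterSystem (M.restrict C) (cs.parabolic C)}

lemma coe_wordProd (h : cs.IsRestriction C csC) (ω : List C) :
    (csC.wordProd ω : W) = cs.wordProd (ω.map Subtype.val) := by
  induction ω with
  | nil => simp
  | cons i ω ih => rw [wordProd_cons, Subgroup.coe_mul, h, ih, List.map_cons, wordProd_cons]

lemma length_eq (h : cs.IsRestriction C csC) (x : cs.parabolic C) :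
    csC.length x = cs.length (x : W) := by
  apply le_antisymm
  · obtain ⟨ν, hν, hred, hx, -⟩ := cs.exists_isReduced_of_mem_parabolic x.2
    lift ν to List C using hν
    have : csC.wordProd ν = x := Subtype.ext (by rw [h.coe_wordProd, hx])
    rw [← hx, hred.eq, ← this, List.length_map]
    exact csC.length_wordProd_le ν
  · obtain ⟨ω, hω, rfl⟩ := csC.exists_isReduced x
    rw [hω.eq, h.coe_wordProd]
    simpa using cs.length_wordProd_le (ω.map Subtype.val)

lemma coe_mem_parabolic_iff (h : cs.IsRestriction C csC) (J : Set B) (x : cs.parabolic C) :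
    x ∈ csC.parabolic (Subtype.val ⁻¹' J) ↔ (x : W) ∈ cs.parabolic (J ∩ C) := by
  have : (csC.parabolic (Subtype.val ⁻¹' J)).map (cs.parabolic C).subtype =
      cs.parabolic (J ∩ C) := by
    change Subgroup.map _ (Subgroup.closure _) = Subgroup.closure _
    rw [MonoidHom.map_closure, ← Set.image_comp]
    congr 1
    ext w
    constructor
    · rintro ⟨s, hs, rfl⟩
      exact ⟨s, ⟨hs, s.2⟩, (h s).symm⟩
    · rintro ⟨s, ⟨hs, hsC⟩, rfl⟩
      exact ⟨⟨s, hsC⟩, hs, h ⟨s, hsC⟩⟩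
  rw [← this]
  simp

lemma isMinRep_iff (h : cs.IsRestriction C csC) (hC : M.IsSaturated C) {J : Set B}
    (x : cs.parabolic C) : csC.IsMinRep (Subtype.val ⁻¹' J) x ↔ cs.IsMinRep J (x : W) := by
  constructor
  · intro hx y hy
    have h1 := hx ⟨cs.retraction C y, retraction_mem hC y⟩
      ((h.coe_mem_parabolic_iff J _).2 (retraction_mem_parabolic_inter hC hy))
    rw [h.length_eq, h.length_eq] at h1
    rw [← length_retraction_add hC ((x : W) * y), map_mul, retraction_eq_self hC x.2]
    exact h1.trans (Nat.le_add_right _ _)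
  · intro hx y hy
    rw [h.length_eq, h.length_eq]
    exact hx _ (cs.parabolic_mono Set.inter_subset_left ((h.coe_mem_parabolic_iff J y).1 hy))

/-- A chain in $W$ may use reflections whose conjugating elements lie outside $W_C$. Retracting the
chain replaces them by elements of $W_C$ and fixes both ends. -/
lemma bruhatLE_iff (h : cs.IsRestriction C csC) (hC : M.IsSaturated C) (x y : cs.parabolic C) :
    csC.BruhatLE x y ↔ cs.BruhatLE (x : W) y := by
  constructor
  · intro hxy
    induction hxy with
    | refl => exact .refl _
    | tail _ hbc ih =>
      refine ih.tail ?_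
      obtain ⟨_, ⟨w, s, rfl⟩, rfl, hlt⟩ := hbc
      refine ⟨_, ⟨w, s, rfl⟩, ?_, ?_⟩
      · simp [h s]
      · rwa [h.length_eq, h.length_eq] at hlt
  · intro hxy
    have key : ∀ u v, cs.BruhatLE u v →
        csC.BruhatLE ⟨cs.retraction C u, retraction_mem hC u⟩
          ⟨cs.retraction C v, retraction_mem hC v⟩ := by
      intro u v huv
      induction huv with
      | refl => exact .refl _
      | tail _ hbc ih =>
        refine ih.trans ?_
        rename_i b c _
        obtain ⟨_, ⟨w, s, rfl⟩, rfl, hlt⟩ := hbc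
        by_cases hs : s ∈ C
        · refine Relation.ReflTransGen.single ⟨_,
            ⟨⟨cs.retraction C w, retraction_mem hC w⟩, ⟨s, hs⟩, rfl⟩, ?_, ?_⟩
          · apply Subtype.ext
            simp [h ⟨s, hs⟩, retraction_simple_of_mem hC hs]
          · rw [h.length_eq, h.length_eq]
            have h1 := length_retraction_add (cs := cs) hC b
            have h2 := length_retraction_add (cs := cs) hC (b * (w * cs.simple s * w⁻¹))
            have h3 : cs.retraction Cᶜ (w * cs.simple s * w⁻¹) = 1 := by
              simp [retraction_simple_of_notMem hC.compl (show s ∉ Cᶜ by simpa)]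
            rw [map_mul (cs.retraction Cᶜ) b, h3, mul_one] at h2
            dsimp only
            omega
        · have : cs.retraction C (b * (w * cs.simple s * w⁻¹)) = cs.retraction C b := by
            simp [retraction_simple_of_notMem hC hs]
          simp only [this]
          exact .refl _
    simpa [retraction_eq_self hC x.2, retraction_eq_self hC y.2] using key x y hxy

/-- The minimal coset representatives of `(W_C, C)` are those of `(W, S)` which lie in `W_C`. -/
noncomputable def minRepIso (h : cs.IsRestriction C csC) (hC : M.IsSaturated C) (J : Set B) :
    csC.QuotientLE (Subtype.val ⁻¹' J) ≃r cs.MinRepLE J C :=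
  (csC.quotientIso _).symm.trans
    { toFun := fun w => ⟨w.1, (h.isMinRep_iff hC w.1).1 w.2.1, w.1.2⟩
      invFun := fun w => ⟨⟨w.1, w.2.2⟩, (h.isMinRep_iff hC ⟨w.1, w.2.2⟩).2 w.2.1,
        by simp [parabolic_univ]⟩
      left_inv := fun _ => rfl
      right_inv := fun _ => rfl
      map_rel_iff' := fun {u v} => (h.bruhatLE_iff hC u.1 v.1).symm }

end IsRestriction

end Restriction

end CoxeterSystem

/-! ### Atoms and links in an abstract order -/

section RelAtom

variable {X Y : Type*} {r : X → X → Prop} {r' : Y → Y → Prop}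

/-- `a` is an atom: it is not a least element, but everything strictly below it is. -/
def RelAtom (r : X → X → Prop) (a : X) : Prop :=
  (¬ ∀ x, r a x) ∧ ∀ y, r y a → y = a ∨ ∀ x, r y x

/-- Two atoms `a` and `b` are linked if some element, with no atom but `a` below it, has no least
upper bound with `b`. -/
def RelLinked (r : X → X → Prop) (a b : X) : Prop :=
  RelAtom r a ∧ RelAtom r b ∧ ∃ x, (∀ c, RelAtom r c → r c x → c = a) ∧
    ¬ ∃ z, r x z ∧ r b z ∧ ∀ z', r x z' → r b z' → r z z'

lemma RelAtom.map {a : X} (h : RelAtom r a) (φ : r ≃r r') : RelAtom r' (φ a) := by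
  refine ⟨fun h' => h.1 fun x => φ.map_rel_iff.1 (h' (φ x)), fun y hy => ?_⟩
  obtain ⟨y, rfl⟩ := φ.surjective y
  rcases h.2 y (φ.map_rel_iff.1 hy) with rfl | h'
  · exact Or.inl rfl
  · right
    intro x
    obtain ⟨x, rfl⟩ := φ.surjective x
    exact φ.map_rel_iff.2 (h' x)

lemma relAtom_map_iff {a : X} (φ : r ≃r r') : RelAtom r' (φ a) ↔ RelAtom r a :=
  ⟨fun h => by simpa using h.map φ.symm, fun h => h.map φ⟩

lemma RelLinked.map {a b : X} (h : RelLinked r a b) (φ : r ≃r r') :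
    RelLinked r' (φ a) (φ b) := by
  obtain ⟨ha, hb, x, hx, hz⟩ := h
  refine ⟨ha.map φ, hb.map φ, φ x, fun c hc hcx => ?_, ?_⟩
  · obtain ⟨c, rfl⟩ := φ.surjective c
    rw [hx c ((relAtom_map_iff φ).1 hc) (φ.map_rel_iff.1 hcx)]
  · rintro ⟨z, h1, h2, h3⟩
    obtain ⟨z, rfl⟩ := φ.surjective z
    exact hz ⟨z, φ.map_rel_iff.1 h1, φ.map_rel_iff.1 h2, fun z' h4 h5 =>
      φ.map_rel_iff.1 (h3 (φ z') (φ.map_rel_iff.2 h4) (φ.map_rel_iff.2 h5))⟩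

lemma eqvGen_relLinked_map {a b : X} (h : Relation.EqvGen (RelLinked r) a b) (φ : r ≃r r') :
    Relation.EqvGen (RelLinked r') (φ a) (φ b) := by
  induction h with
  | rel _ _ h => exact .rel _ _ (h.map φ)
  | refl _ => exact .refl _
  | symm _ _ _ ih => exact ih.symm
  | trans _ _ _ _ _ ih1 ih2 => exact ih1.trans _ _ _ ih2

end RelAtom

/-! ### Recovering the components from the order -/

namespace CoxeterMatrix

variable {B : Type*} {M : CoxeterMatrix B}

lemma isSaturated_setOf_reachable (s : B) :
    M.IsSaturated {t | M.coxeterGraph.Reachable s t} := by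
  intro t ht u hu
  by_contra hne
  have htu : t ≠ u := by rintro rfl; exact hu ht
  exact hu (SimpleGraph.Reachable.trans ht (SimpleGraph.Adj.reachable
    (show M.coxeterGraph.Adj t u from ⟨htu, hne⟩)))

lemma irreducible_restrict_setOf_reachable (s : B) :
    (M.restrict {t | M.coxeterGraph.Reachable s t}).Irreducible := by
  have hgraph : (M.restrict {t | M.coxeterGraph.Reachable s t}).coxeterGraph =
      M.coxeterGraph.induce {t | M.coxeterGraph.Reachable s t} := by
    ext a b
    simp [coxeterGraph, restrict, Subtype.ext_iff]
    rfl
  have hset : {t | M.coxeterGraph.Reachable s t} =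
      (M.coxeterGraph.connectedComponentMk s).supp := by
    ext t
    simp [SimpleGraph.ConnectedComponent.mem_supp_iff, SimpleGraph.reachable_comm]
  rw [Irreducible, hgraph, hset]
  exact (M.coxeterGraph.connectedComponentMk s).connected_toSimpleGraph

end CoxeterMatrix

namespace CoxeterSystem

open CoxeterMatrix

variable {B W : Type*} [Group W] {M : CoxeterMatrix B} {cs : CoxeterSystem M W} {J : Set B}

section Atoms

lemma minRepLE_iff {I : Set B} {u v : {w : W // cs.IsMinRep J w ∧ w ∈ cs.parabolic I}} :
    cs.MinRepLE J I u v ↔ cs.BruhatLE u.1 v.1 := Iff.rfl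

variable (cs) in
/-- The minimal coset representative given by a generator outside `J`. -/
noncomputable def simpleRep {s : B} (hs : s ∉ J) :
    {w : W // cs.IsMinRep J w ∧ w ∈ cs.parabolic Set.univ} :=
  ⟨cs.simple s, cs.isMinRep_simple hs, by simp [parabolic_univ]⟩

lemma not_simple_bruhatLE_one (s : B) : ¬ cs.BruhatLE (cs.simple s) 1 := by
  intro h
  simpa using h.length_le

lemma IsMinRep.exists_simple_bruhatLE {w : W} (hw : cs.IsMinRep J w) (h1 : w ≠ 1) :
    ∃ s ∉ J, cs.BruhatLE (cs.simple s) w := by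
  obtain ⟨s, hs⟩ := cs.exists_rightDescent_of_ne_one h1
  refine ⟨s, fun hsJ => ?_, simple_bruhatLE_of_isRightDescent hs⟩
  have := hw.length_mul_simple hsJ
  rw [IsRightDescent] at hs
  omega

/-- The least element is $1$, and any other minimal representative lies above its right descents,
none of which is in $J$. -/
lemma relAtom_iff (x : {w : W // cs.IsMinRep J w ∧ w ∈ cs.parabolic Set.univ}) :
    RelAtom (cs.MinRepLE J Set.univ) x ↔ ∃ s, ∃ hs : s ∉ J, x = cs.simpleRep hs := by
  constructor
  · rintro ⟨h1, h2⟩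
    have hx : x.1 ≠ 1 := fun h => h1 fun y => by
      rw [MinRepLE, h]; exact one_bruhatLE _
    obtain ⟨s, hs, hle⟩ := x.2.1.exists_simple_bruhatLE hx
    refine ⟨s, hs, ?_⟩
    rcases h2 (cs.simpleRep hs) hle with h | h
    · exact h.symm
    · exact absurd (h ⟨1, isMinRep_one, one_mem _⟩) (not_simple_bruhatLE_one s)
  · rintro ⟨s, hs, rfl⟩
    refine ⟨fun h => not_simple_bruhatLE_one s (h ⟨1, isMinRep_one, one_mem _⟩), fun y hy => ?_⟩
    rcases BruhatLE.length_lt_or_eq hy with h | h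
    · right
      intro x
      have : y.1 = 1 := by
        rw [← cs.length_eq_zero_iff]
        simp only [simpleRep, length_simple] at h
        omega
      rw [MinRepLE, this]
      exact one_bruhatLE _
    · exact Or.inl (Subtype.ext h)

lemma relAtom_simpleRep {s : B} (hs : s ∉ J) :
    RelAtom (cs.MinRepLE J Set.univ) (cs.simpleRep hs) := (relAtom_iff _).2 ⟨s, hs, rfl⟩

lemma simpleRep_inj {s t : B} {hs : s ∉ J} {ht : t ∉ J} :
    cs.simpleRep hs = cs.simpleRep ht ↔ s = t := by
  constructor
  · intro h
    exact cs.simple_injective (congrArg Subtype.val h)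
  · rintro rfl; rfl

lemma simple_bruhatLE_mem {C : Set B} {s : B} {w : W} (hw : w ∈ cs.parabolic C)
    (h : cs.BruhatLE (cs.simple s) w) : s ∈ C :=
  cs.simple_mem_parabolic_iff.1 (h.mem_parabolic hw)

/-- Membership in `W_C` is detected by the atoms. -/
lemma IsMinRep.mem_parabolic_iff {C : Set B} (hC : M.IsSaturated C) {w : W}
    (hw : cs.IsMinRep J w) :
    w ∈ cs.parabolic C ↔ ∀ s ∉ J, cs.BruhatLE (cs.simple s) w → s ∈ C := by
  refine ⟨fun h s _ hs => simple_bruhatLE_mem h hs, fun h => ?_⟩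
  -- A nontrivial component outside $C$ would lie above an atom outside $C$, and `w` lies above each
  -- of its components.
  have h1 : cs.retraction Cᶜ w = 1 := by
    by_contra hne
    obtain ⟨s, hs, hle⟩ := (hw.retraction hC.compl).exists_simple_bruhatLE hne
    have hsC : s ∈ Cᶜ := simple_bruhatLE_mem (retraction_mem hC.compl w) hle
    refine hsC (h s hs (hle.trans ?_))
    have := BruhatLE.mul_of_disjoint (cs := cs) hC hC.compl disjoint_compl_right (one_mem _)
      (retraction_mem hC w) (retraction_mem hC.compl w) (retraction_mem hC.compl w)
      (one_bruhatLE _) (.refl _)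
    rwa [retraction_mul_retraction_compl hC, one_mul] at this
  rw [← retraction_mul_retraction_compl hC w, h1, mul_one]
  exact retraction_mem hC w

end Atoms

section Linked

/-- If $t$ were outside the component $C$ of $s$, the only atom below $x$ being $s$ would force
$x\in W_C$. Then $xt$ is the join of $x$ and $t$, by comparing components. -/
lemma reachable_of_relLinked {s t : B} {hs : s ∉ J} {ht : t ∉ J}
    (h : RelLinked (cs.MinRepLE J Set.univ) (cs.simpleRep hs) (cs.simpleRep ht)) :
    M.coxeterGraph.Reachable s t := by
  obtain ⟨-, -, x, hx, hz⟩ := h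
  by_contra hst
  set C : Set B := {t | M.coxeterGraph.Reachable s t}
  have hC : M.IsSaturated C := isSaturated_setOf_reachable s
  have htC : t ∈ Cᶜ := hst
  have hxC : x.1 ∈ cs.parabolic C := by
    rw [x.2.1.mem_parabolic_iff hC]
    intro r hr hrx
    rw [simpleRep_inj.1 (hx _ (relAtom_simpleRep hr) hrx)]
    exact SimpleGraph.Reachable.refl _
  have htC' := cs.simple_mem_parabolic htC
  have hmin : cs.IsMinRep J (x.1 * cs.simple t) :=
    x.2.1.mul_of_disjoint hC disjoint_compl_right (cs.isMinRep_simple ht) hxC htC'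
  refine hz ⟨⟨x.1 * cs.simple t, hmin, by simp [parabolic_univ]⟩, ?_, ?_, fun z h1 h2 => ?_⟩
  · simpa [minRepLE_iff, simpleRep] using BruhatLE.mul_of_disjoint hC hC.compl disjoint_compl_right hxC hxC
      (one_mem _) htC' (.refl _) (one_bruhatLE _)
  · simpa [minRepLE_iff, simpleRep] using BruhatLE.mul_of_disjoint hC hC.compl disjoint_compl_right (one_mem _) hxC
      htC' htC' (one_bruhatLE _) (.refl _)
  · have h1' := BruhatLE.retraction hC h1
    have h2' := BruhatLE.retraction hC.compl h2
    rw [retraction_eq_self hC hxC] at h1'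
    simp only [simpleRep, retraction_eq_self hC.compl htC'] at h2'
    have := BruhatLE.mul_of_disjoint hC hC.compl disjoint_compl_right hxC (retraction_mem hC _)
      htC' (retraction_mem hC.compl _) h1' h2'
    rwa [retraction_mul_retraction_compl hC] at this

/-- The product of the generators along a path which ends outside `J` but otherwise runs in `J` is a
minimal coset representative; it does not commute with any neighbour of the start of the path. -/
lemma exists_isMinRep_of_isPath {v s : B} (p : M.coxeterGraph.Walk v s) (hp : p.IsPath)
    (hs : s ∉ J) (hpJ : ∀ x ∈ p.support, x ∈ J ∨ x = s) :
    ∃ a, cs.IsMinRep J a ∧ a ∈ cs.parabolic {x | x ∈ p.support} ∧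
      ∀ t, M.coxeterGraph.Adj t v → t ∉ p.support →
        cs.simple t * a ≠ a * cs.simple t := by
  induction p with
  | nil =>
    refine ⟨_, cs.isMinRep_simple hs, cs.simple_mem_parabolic (by simp), fun t ht _ h => ?_⟩
    exact ht.2 ((cs.simple_mul_comm_iff ht.1).1 h)
  | cons hadj q ih =>
    rename_i v u s
    rw [SimpleGraph.Walk.cons_isPath_iff] at hp
    obtain ⟨a, ha, haq, hcomm⟩ := ih hp.1 hs fun x hx => hpJ x (by simp [hx])
    have hsub : {x | x ∈ q.support} ⊆ {x | x ∈ (SimpleGraph.Walk.cons hadj q).support} :=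
      fun x hx => List.mem_cons_of_mem _ hx
    refine ⟨cs.simple v * a, ha.simple_mul haq hp.2 fun _ => hcomm v hadj hp.2,
      mul_mem (cs.simple_mem_parabolic (by simp)) (cs.parabolic_mono hsub haq),
      fun t ht htp h => ?_⟩
    have htv : t ≠ v := ht.1
    -- If $t$ commuted with $va$, then $vtv=ata^{-1}$ would lie in a parabolic subgroup not
    -- containing $v$. That forces $v$ and $t$ to commute, although they are joined by an edge.
    have h1 : cs.simple v * cs.simple t * cs.simple v = a * cs.simple t * a⁻¹ := by
      rw [eq_mul_inv_iff_mul_eq, mul_assoc, mul_assoc, h]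
      simp [mul_assoc]
    have h2 := cs.comm_of_conj_simple_mem_parabolic (J := insert t {x | x ∈ q.support}) (t := v)
      (j := t) (by simpa [htv.symm] using hp.2) htv (by
        have haq' := cs.parabolic_mono (Set.subset_insert t _) haq
        rw [h1]
        exact mul_mem (mul_mem haq' (cs.simple_mem_parabolic (Set.mem_insert t _))) (inv_mem haq'))
    exact ht.2 ((cs.simple_mul_comm_iff ht.1).1 h2.symm)

/-- The witness is the product $a$ along the path. A join $z$ of $a$ and $t$ would lie below both
$ta$ and $at$, which have length $\ell(a)+1$. As $t\not\le a$, $z$ is longer than $a$, so $ta=z=at$,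
contrary to the choice of $a$. -/
lemma relLinked_of_walk {v s t : B} (p : M.coxeterGraph.Walk v s) (hs : s ∉ J) (ht : t ∉ J)
    (hpJ : ∀ x ∈ p.support, x ∈ J ∨ x = s) (htv : M.coxeterGraph.Adj t v) (hts : t ≠ s) :
    RelLinked (cs.MinRepLE J Set.univ) (cs.simpleRep hs) (cs.simpleRep ht) := by
  classical
  obtain ⟨q, hq, hqJ⟩ : ∃ q : M.coxeterGraph.Walk v s, q.IsPath ∧
      ∀ x ∈ q.support, x ∈ J ∨ x = s :=
    ⟨p.bypass, p.bypass_isPath, fun x hx => hpJ x (p.support_bypass_subset_support hx)⟩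
  have htp : t ∉ q.support := fun h => (hqJ t h).elim ht hts
  obtain ⟨a, ha, hap, hcomm⟩ := exists_isMinRep_of_isPath (cs := cs) q hq hs hqJ
  have hl1 := cs.length_simple_mul_of_mem_parabolic htp hap
  have hl2 := cs.length_mul_simple_of_mem_parabolic htp hap
  have h1 : cs.IsMinRep J (cs.simple t * a) := ha.simple_mul hap htp fun h => absurd h ht
  have h2 : cs.IsMinRep J (a * cs.simple t) := ha.mul_simple hap htp ht
  refine ⟨relAtom_simpleRep hs, relAtom_simpleRep ht, ⟨a, ha, by simp [parabolic_univ]⟩, ?_, ?_⟩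
  · intro c hc hca
    obtain ⟨r, hr, rfl⟩ := (relAtom_iff c).1 hc
    have hrq := simple_bruhatLE_mem hap hca
    exact simpleRep_inj.2 ((hqJ r hrq).resolve_left hr)
  · rintro ⟨z, haz, htz, hz⟩
    have e1 : cs.BruhatLE a (cs.simple t * a) := bruhatLE_simple_mul (by omega)
    have e2 : cs.BruhatLE (cs.simple t) (cs.simple t * a) := simple_bruhatLE_simple_mul (by omega)
    have e3 : cs.BruhatLE a (a * cs.simple t) := bruhatLE_mul_simple (by omega)
    have e4 : cs.BruhatLE (cs.simple t) (a * cs.simple t) :=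
      simple_bruhatLE_of_isRightDescent (by simp [IsRightDescent, hl2])
    have hz1 : cs.BruhatLE z.1 (cs.simple t * a) :=
      minRepLE_iff.1 (hz ⟨_, h1, by simp [parabolic_univ]⟩ (minRepLE_iff.2 e1)
        (minRepLE_iff.2 e2))
    have hz2 : cs.BruhatLE z.1 (a * cs.simple t) :=
      minRepLE_iff.1 (hz ⟨_, h2, by simp [parabolic_univ]⟩ (minRepLE_iff.2 e3)
        (minRepLE_iff.2 e4))
    rcases BruhatLE.length_lt_or_eq haz with h | h
    · exact hcomm t htv htp
        ((hz1.eq_of_length_le (by rw [hl1]; exact h)).symm.trans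
          (hz2.eq_of_length_le (by rw [hl2]; exact h)))
    · rw [MinRepLE, ← h] at htz
      have htq := simple_bruhatLE_mem hap htz
      exact htp htq

/-- Here `s'` is the first vertex of the walk outside `J`; consecutive distinct vertices outside `J`
are linked because the stretch between them runs in `J`. -/
lemma exists_walk_eqvGen {v s : B} (p : M.coxeterGraph.Walk v s) (hs : s ∉ J) :
    ∃ s', ∃ hs' : s' ∉ J, ∃ q : M.coxeterGraph.Walk v s', (∀ x ∈ q.support, x ∈ J ∨ x = s') ∧
      Relation.EqvGen (RelLinked (cs.MinRepLE J Set.univ)) (cs.simpleRep hs')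
        (cs.simpleRep hs) := by
  induction p with
  | nil => exact ⟨_, hs, .nil, by simp, .refl _⟩
  | cons hadj p ih =>
    rename_i v u s
    obtain ⟨s', hs', q, hq, he⟩ := ih hs
    by_cases hv : v ∈ J
    · exact ⟨s', hs', .cons hadj q, by simpa [hv] using hq, he⟩
    · refine ⟨v, hv, .nil, by simp, ?_⟩
      rcases eq_or_ne v s' with rfl | hvs
      · exact he
      · exact .trans _ _ _ (.symm _ _ (.rel _ _ (relLinked_of_walk q hs' hv hq hadj hvs))) he

/-- The connected components of the Coxeter graph are determined by the order on the minimal coset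
representatives. -/
theorem eqvGen_relLinked_iff {s t : B} (hs : s ∉ J) (ht : t ∉ J) :
    Relation.EqvGen (RelLinked (cs.MinRepLE J Set.univ)) (cs.simpleRep hs) (cs.simpleRep ht) ↔
      M.coxeterGraph.Reachable s t := by
  constructor
  · intro h
    -- The generated equivalence is reflexive at non-atoms too, hence the alternative `a = b`.
    have key : ∀ a b, Relation.EqvGen (RelLinked (cs.MinRepLE J Set.univ)) a b → a = b ∨
        ∃ s t, ∃ hs : s ∉ J, ∃ ht : t ∉ J, a = cs.simpleRep hs ∧ b = cs.simpleRep ht ∧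
          M.coxeterGraph.Reachable s t := by
      intro a b h
      induction h with
      | rel a b h =>
        obtain ⟨s, hs, rfl⟩ := (relAtom_iff a).1 h.1
        obtain ⟨t, ht, rfl⟩ := (relAtom_iff b).1 h.2.1
        exact Or.inr ⟨s, t, hs, ht, rfl, rfl, reachable_of_relLinked h⟩
      | refl => exact Or.inl rfl
      | symm a b _ ih =>
        rcases ih with rfl | ⟨s, t, hs, ht, rfl, rfl, h⟩
        · exact Or.inl rfl
        · exact Or.inr ⟨t, s, ht, hs, rfl, rfl, h.symm⟩
      | trans a b c _ _ ih1 ih2 =>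
        rcases ih1 with rfl | ⟨s, t, hs, ht, rfl, rfl, h1⟩
        · exact ih2
        rcases ih2 with rfl | ⟨t', u, ht', hu, h2, rfl, h3⟩
        · exact Or.inr ⟨s, t, hs, ht, rfl, rfl, h1⟩
        · rw [simpleRep_inj] at h2
          subst h2
          exact Or.inr ⟨s, u, hs, hu, rfl, rfl, h1.trans h3⟩
    rcases key _ _ h with h | ⟨s', t', hs', ht', h1, h2, h3⟩
    · rw [simpleRep_inj] at h
      exact h ▸ SimpleGraph.Reachable.refl _
    · rw [simpleRep_inj] at h1 h2
      rwa [h1, h2]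
  · rintro ⟨p⟩
    obtain ⟨s', hs', q, hq, he⟩ := exists_walk_eqvGen (cs := cs) p ht
    obtain rfl := (hq s q.start_mem_support).resolve_left hs
    exact he

end Linked

end CoxeterSystem

/-! ### Matching the components of the two systems -/

/-- Relation isomorphisms of the factors induce one of the products. -/
def RelIso.piCongr {ι : Type*} {X Y : ι → Type*} {r : ∀ i, X i → X i → Prop}
    {r' : ∀ i, Y i → Y i → Prop} (φ : ∀ i, r i ≃r r' i) :
    (fun f g : ∀ i, X i => ∀ i, r i (f i) (g i)) ≃r
      (fun f g : ∀ i, Y i => ∀ i, r' i (f i) (g i)) where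
  toEquiv := Equiv.piCongrRight fun i => (φ i).toEquiv
  map_rel_iff' := forall_congr' fun i => (φ i).map_rel_iff

namespace CoxeterMatrix

variable {B : Type*} {M : CoxeterMatrix B}

lemma IsDisjointUnion.of_isSaturated {n : ℕ} {P : Fin n → Set B} (h : ∀ i, M.IsSaturated (P i))
    (hd : Pairwise (Function.onFun Disjoint P)) (hc : ⋃ i, P i = Set.univ) :
    M.IsDisjointUnion P :=
  ⟨fun _ _ hij => hd hij, hc, fun i _ hij s hs t ht hadj =>
    hadj.2 (h i s hs t ((hd hij).notMem_of_mem_right ht))⟩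

end CoxeterMatrix

namespace CoxeterSystem

open CoxeterMatrix

variable {B B' W U : Type*} [Group W] [Group U] {M : CoxeterMatrix B} {M' : CoxeterMatrix B'}
  {cs : CoxeterSystem M W} {cs' : CoxeterSystem M' U} {J : Set B} {K : Set B'}

/-- An isomorphism of orders which matches the atoms in `C` with those in `D` restricts to an
isomorphism of the orders attached to `C` and `D`. -/
def minRepRestrictIso (φ : cs.MinRepLE J Set.univ ≃r cs'.MinRepLE K Set.univ)
    {C : Set B} {D : Set B'} (hC : M.IsSaturated C) (hD : M'.IsSaturated D)
    (h : ∀ (s : B) (hs : s ∉ J) (t : B') (ht : t ∉ K),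
      φ (cs.simpleRep hs) = cs'.simpleRep ht → (s ∈ C ↔ t ∈ D)) :
    cs.MinRepLE J C ≃r cs'.MinRepLE K D := by
  have huniv : ∀ w : W, w ∈ cs.parabolic Set.univ := by simp [parabolic_univ]
  have huniv' : ∀ w : U, w ∈ cs'.parabolic Set.univ := by simp [parabolic_univ]
  have key : ∀ x, x.1 ∈ cs.parabolic C ↔ (φ x).1 ∈ cs'.parabolic D := by
    intro x
    rw [x.2.1.mem_parabolic_iff hC, (φ x).2.1.mem_parabolic_iff hD]
    constructor
    · intro hx t ht htx
      obtain ⟨s, hs, hst⟩ := (relAtom_iff _).1 ((relAtom_simpleRep (cs := cs') ht).map φ.symm)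
      have hst' : φ (cs.simpleRep hs) = cs'.simpleRep ht := by rw [← hst, φ.apply_symm_apply]
      refine (h s hs t ht hst').1 (hx s hs ?_)
      have : cs'.MinRepLE K Set.univ (φ (cs.simpleRep hs)) (φ x) := by rw [hst']; exact htx
      exact φ.map_rel_iff.1 this
    · intro hx s hs hsx
      obtain ⟨t, ht, hst⟩ := (relAtom_iff _).1 ((relAtom_simpleRep (cs := cs) hs).map φ)
      refine (h s hs t ht hst).2 (hx t ht ?_)
      have : cs'.MinRepLE K Set.univ (φ (cs.simpleRep hs)) (φ x) := φ.map_rel_iff.2 hsx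
      rwa [hst] at this
  exact
    { toFun := fun x => ⟨(φ ⟨x.1, x.2.1, huniv _⟩).1, (φ ⟨x.1, x.2.1, huniv _⟩).2.1,
        (key _).1 x.2.2⟩
      invFun := fun y => ⟨(φ.symm ⟨y.1, y.2.1, huniv' _⟩).1, (φ.symm ⟨y.1, y.2.1, huniv' _⟩).2.1,
        (key _).2 (by simpa using y.2.2)⟩
      left_inv := fun x => by simp
      right_inv := fun y => by simp
      map_rel_iff' := fun {x y} => φ.map_rel_iff (a := ⟨x.1, x.2.1, huniv _⟩)
        (b := ⟨y.1, y.2.1, huniv _⟩) }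

/-- A generator `s` outside `J` and a generator `t` outside `K` correspond under `φ`. -/
def AtomMatch (φ : cs.MinRepLE J Set.univ ≃r cs'.MinRepLE K Set.univ) (s : B) (t : B') : Prop :=
  ∃ (hs : s ∉ J) (ht : t ∉ K), φ (cs.simpleRep hs) = cs'.simpleRep ht

variable {φ : cs.MinRepLE J Set.univ ≃r cs'.MinRepLE K Set.univ}

lemma AtomMatch.reachable_iff {s₁ s₂ : B} {t₁ t₂ : B'} (h₁ : AtomMatch φ s₁ t₁)
    (h₂ : AtomMatch φ s₂ t₂) :
    M.coxeterGraph.Reachable s₁ s₂ ↔ M'.coxeterGraph.Reachable t₁ t₂ := by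
  obtain ⟨hs₁, ht₁, h₁⟩ := h₁
  obtain ⟨hs₂, ht₂, h₂⟩ := h₂
  rw [← eqvGen_relLinked_iff (cs := cs) hs₁ hs₂, ← eqvGen_relLinked_iff (cs := cs') ht₁ ht₂]
  refine ⟨fun h => ?_, fun h => ?_⟩
  · rw [← h₁, ← h₂]
    exact eqvGen_relLinked_map h φ
  · simpa [← h₁, ← h₂] using eqvGen_relLinked_map h φ.symm

lemma exists_atomMatch (φ : cs.MinRepLE J Set.univ ≃r cs'.MinRepLE K Set.univ) {t : B'}
    (ht : t ∉ K) : ∃ s, AtomMatch φ s t := by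
  obtain ⟨s, hs, hst⟩ := (relAtom_iff _).1 ((relAtom_simpleRep (cs := cs') ht).map φ.symm)
  exact ⟨s, hs, ht, by rw [← hst, φ.apply_symm_apply]⟩

/-- The parts of the first system: its connected components, and an empty set for each component of
the second system. -/
def sourcePart (M : CoxeterMatrix B) (M' : CoxeterMatrix B') :
    M.coxeterGraph.ConnectedComponent ⊕ M'.coxeterGraph.ConnectedComponent → Set B :=
  Sum.elim (fun c => c.supp) fun _ => ∅

/-- The parts of the second system: the components which `φ` matches with components of the first
system, and the components contained in `K`. -/
def targetPart (φ : cs.MinRepLE J Set.univ ≃r cs'.MinRepLE K Set.univ) :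
    M.coxeterGraph.ConnectedComponent ⊕ M'.coxeterGraph.ConnectedComponent → Set B' :=
  Sum.elim
    (fun c => {t | ∃ s ∈ c.supp, ∃ t₀, AtomMatch φ s t₀ ∧ M'.coxeterGraph.Reachable t₀ t})
    fun c => {t | t ∈ c.supp ∧ c.supp ⊆ K}

lemma supp_connectedComponentMk (M : CoxeterMatrix B) (s : B) :
    (M.coxeterGraph.connectedComponentMk s).supp = {t | M.coxeterGraph.Reachable s t} := by
  ext t
  simp [SimpleGraph.ConnectedComponent.mem_supp_iff, SimpleGraph.reachable_comm]

lemma sourcePart_eq (i : M.coxeterGraph.ConnectedComponent ⊕ M'.coxeterGraph.ConnectedComponent) :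
    sourcePart M M' i = ∅ ∨ ∃ s, sourcePart M M' i = {t | M.coxeterGraph.Reachable s t} := by
  rcases i with c | c
  · induction c using SimpleGraph.ConnectedComponent.ind with
    | h s => exact Or.inr ⟨s, supp_connectedComponentMk M s⟩
  · exact Or.inl rfl

/-- All atoms of one component are matched into a single component. The part is empty for a left
index with no atoms, and for a right index whose component is not contained in `K`. -/
lemma targetPart_eq (i : M.coxeterGraph.ConnectedComponent ⊕ M'.coxeterGraph.ConnectedComponent) :
    targetPart φ i = ∅ ∨ ∃ t, targetPart φ i = {u | M'.coxeterGraph.Reachable t u} := by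
  rw [or_iff_not_imp_left, ← ne_eq, ← Set.nonempty_iff_ne_empty]
  rcases i with c | c
  · rintro ⟨-, s, hs, t, hst, -⟩
    refine ⟨t, Set.ext fun u => ⟨?_, fun hu => ⟨s, hs, t, hst, hu⟩⟩⟩
    rintro ⟨s', hs', t', hst', hu⟩
    have hss' : M.coxeterGraph.Reachable s s' :=
      SimpleGraph.ConnectedComponent.exact (Eq.trans hs (Eq.symm hs'))
    exact ((hst.reachable_iff hst').1 hss').trans hu
  · rintro ⟨t, ht, hK⟩
    refine ⟨t, ?_⟩
    rw [← supp_connectedComponentMk, show M'.coxeterGraph.connectedComponentMk t = c from ht]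
    exact Set.ext fun u => ⟨fun h => h.1, fun h => ⟨h, hK⟩⟩

lemma isSaturated_of_eq {C : Set B}
    (h : C = ∅ ∨ ∃ s, C = {t | M.coxeterGraph.Reachable s t}) : M.IsSaturated C := by
  rcases h with rfl | ⟨s, rfl⟩
  exacts [isSaturated_empty, isSaturated_setOf_reachable s]

lemma irreducible_or_eq_empty {C : Set B}
    (h : C = ∅ ∨ ∃ s, C = {t | M.coxeterGraph.Reachable s t}) :
    (M.restrict C).Irreducible ∨ C = ∅ := by
  rcases h with rfl | ⟨s, rfl⟩
  exacts [Or.inr rfl, Or.inl (irreducible_restrict_setOf_reachable s)]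

lemma pairwise_disjoint_sourcePart :
    Pairwise (Function.onFun Disjoint (sourcePart M M')) := by
  intro i j hij
  rw [Function.onFun, Set.disjoint_left]
  rintro s hi hj
  rcases i with c | c
  · rcases j with d | d
    · exact hij (congrArg Sum.inl (Eq.trans (Eq.symm hi) hj))
    · exact hj
  · exact hi

lemma iUnion_sourcePart : ⋃ i, sourcePart M M' i = Set.univ := by
  refine Set.eq_univ_of_forall fun s => Set.mem_iUnion.2
    ⟨Sum.inl (M.coxeterGraph.connectedComponentMk s), rfl⟩

lemma pairwise_disjoint_targetPart (φ : cs.MinRepLE J Set.univ ≃r cs'.MinRepLE K Set.univ) :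
    Pairwise (Function.onFun Disjoint (targetPart φ)) := by
  have key : ∀ (c : M.coxeterGraph.ConnectedComponent) (d : M'.coxeterGraph.ConnectedComponent) u,
      u ∈ targetPart φ (Sum.inl c) → u ∉ targetPart φ (Sum.inr d) := by
    rintro c d u ⟨s, hs, t, ⟨_, ht, _⟩, hu⟩ ⟨hud, hK⟩
    exact ht (hK ((SimpleGraph.ConnectedComponent.sound hu).trans hud))
  intro i j hij
  rw [Function.onFun, Set.disjoint_left]
  intro u hi hj
  rcases i with c | c <;> rcases j with d | d
  · obtain ⟨s, hs, t, hst, hu⟩ := hi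
    obtain ⟨s', hs', t', hst', hu'⟩ := hj
    have h := (hst.reachable_iff hst').2 (hu.trans hu'.symm)
    exact hij (congrArg Sum.inl
      ((Eq.symm hs).trans ((SimpleGraph.ConnectedComponent.sound h).trans hs')))
  · exact key c d u hi hj
  · exact key d c u hj hi
  · exact hij (congrArg Sum.inr ((Eq.symm hi.1).trans hj.1))

lemma iUnion_targetPart (φ : cs.MinRepLE J Set.univ ≃r cs'.MinRepLE K Set.univ) :
    ⋃ i, targetPart φ i = Set.univ := by
  refine Set.eq_univ_of_forall fun u => Set.mem_iUnion.2 ?_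
  by_cases hK : (M'.coxeterGraph.connectedComponentMk u).supp ⊆ K
  · exact ⟨Sum.inr (M'.coxeterGraph.connectedComponentMk u), rfl, hK⟩
  · obtain ⟨t, htu, htK⟩ := Set.not_subset.1 hK
    obtain ⟨s, hs⟩ := exists_atomMatch φ htK
    exact ⟨Sum.inl (M.coxeterGraph.connectedComponentMk s), s, rfl, t, hs,
      SimpleGraph.ConnectedComponent.exact htu⟩

/-- This is the compatibility needed by `minRepRestrictIso`. At a right index neither side can hold:
the source part is empty, and the target part lies in `K`, which excludes `t`. -/
lemma AtomMatch.mem_iff {s : B} {t : B'} (h : AtomMatch φ s t)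
    (i : M.coxeterGraph.ConnectedComponent ⊕ M'.coxeterGraph.ConnectedComponent) :
    s ∈ sourcePart M M' i ↔ t ∈ targetPart φ i := by
  rcases i with c | c
  · refine ⟨fun hs => ⟨s, hs, t, h, .refl _⟩, ?_⟩
    rintro ⟨s', hs', t', h', htt'⟩
    exact (SimpleGraph.ConnectedComponent.sound ((h'.reachable_iff h).2 htt').symm).trans hs'
  · refine ⟨fun hs => hs.elim, fun ht => ?_⟩
    exact absurd (ht.2 ht.1) h.2.1

end CoxeterSystem

open CoxeterMatrix CoxeterSystem in
theorem theorem2 {B B' W U : Type*} [Finite B] [Finite B'] [Group W] [Group U]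
    {M : CoxeterMatrix B} {M' : CoxeterMatrix B'}
    (cs : CoxeterSystem M W) (cs' : CoxeterSystem M' U) (J : Set B) (K : Set B') :
    Nonempty (cs.QuotientLE J ≃r cs'.QuotientLE K) ↔
      ∃ (n : ℕ) (P : Fin n → Set B) (Q : Fin n → Set B'),
        M.IsDisjointUnion P ∧ M'.IsDisjointUnion Q ∧
        ∀ i : Fin n,
          ∃ (csP : CoxeterSystem (M.restrict (P i)) (cs.parabolic (P i)))
            (csQ : CoxeterSystem (M'.restrict (Q i)) (cs'.parabolic (Q i))),
            cs.IsRestriction (P i) csP ∧ cs'.IsRestriction (Q i) csQ ∧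
            ((M.restrict (P i)).Irreducible ∨ P i = ∅) ∧
            ((M'.restrict (Q i)).Irreducible ∨ Q i = ∅) ∧
            Nonempty (csP.QuotientLE (Subtype.val ⁻¹' J) ≃r
              csQ.QuotientLE (Subtype.val ⁻¹' K)) := by
  constructor
  · rintro ⟨ψ⟩
    let φ := ((cs.quotientIso J).trans ψ).trans (cs'.quotientIso K).symm
    have : Finite M.coxeterGraph.ConnectedComponent := Quot.finite _
    have : Finite M'.coxeterGraph.ConnectedComponent := Quot.finite _
    obtain ⟨n, ⟨e⟩⟩ := Finite.exists_equiv_fin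
      (M.coxeterGraph.ConnectedComponent ⊕ M'.coxeterGraph.ConnectedComponent)
    have hP := fun i => isSaturated_of_eq (sourcePart_eq (M := M) (M' := M') (e.symm i))
    have hQ := fun i => isSaturated_of_eq (targetPart_eq (φ := φ) (e.symm i))
    refine ⟨n, sourcePart M M' ∘ e.symm, targetPart φ ∘ e.symm,
      .of_isSaturated hP (pairwise_disjoint_sourcePart.comp_of_injective e.symm.injective) ?_,
      .of_isSaturated hQ ((pairwise_disjoint_targetPart φ).comp_of_injective e.symm.injective) ?_,
      fun i => ?_⟩
    · rw [← iUnion_sourcePart (M := M) (M' := M')]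
      exact e.symm.surjective.iUnion_comp _
    · rw [← iUnion_targetPart φ]
      exact e.symm.surjective.iUnion_comp _
    · obtain ⟨csP, hcsP⟩ := cs.exists_isRestriction (hP i)
      obtain ⟨csQ, hcsQ⟩ := cs'.exists_isRestriction (hQ i)
      refine ⟨csP, csQ, hcsP, hcsQ, irreducible_or_eq_empty (sourcePart_eq _),
        irreducible_or_eq_empty (targetPart_eq _), ⟨?_⟩⟩
      exact ((hcsP.minRepIso (hP i) J).trans (minRepRestrictIso φ (hP i) (hQ i)
        fun s hs t ht hst => AtomMatch.mem_iff ⟨hs, ht, hst⟩ _)).trans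
        (hcsQ.minRepIso (hQ i) K).symm
  · rintro ⟨n, P, Q, hP, hQ, h⟩
    choose csP csQ hcsP hcsQ _ _ hiso using h
    let ψ := fun i => Classical.choice (hiso i)
    exact ⟨((cs.quotientIso J).symm.trans
      ((minRepProdIso hP.isSaturated (fun i j => hP.disjoint i j) hP.cover J).trans
      ((RelIso.piCongr fun i => ((hcsP i).minRepIso (hP.isSaturated i) J).symm.trans
        ((ψ i).trans ((hcsQ i).minRepIso (hQ.isSaturated i) K))).trans
      (minRepProdIso hQ.isSaturated (fun i j => hQ.disjoint i j) hQ.cover K).symm))).trans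
      (cs'.quotientIso K)⟩
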